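/- Let $p,q\in[0,1]$ with $p\neq 1/2$, let $c\ge 0$, and put $a=2p-1$ and $\lambda=1/(c+1)$. Let $(S_n)_{n\ge0}$ be the reinforced elephant random walk with memory parameter $p$, first-step parameter $q$ and reinforcement $c$: $S_0=0$ and $S_n=X_1+\dots+X_n$, where $\mathbb P(X_1=1)=q=1-\mathbb P(X_1=-1)$ and, for $n\ge1$, almost surely $X_{n+1}=\alpha_{n+1}X_{\beta_{n+1}}$. Here, with $\mathcal F_n=\sigma(X_1,\dots,X_n,\beta_2,\dots,\beta_n)$: - the conditional law of $\beta_{n+1}$ is $\mathbb P(\beta_{n+1}=k\mid\mathcal F_n)=\rho_n(k)/\sum_{j=1}^n\rho_n(j)$ for $1\le k\le n$, where the weights are $\rho_n(n)=1$, $\rho_n(k)=\rho_{n-1}(k)+c\,\mathbf 1_{\{\beta_n=k\}}$ for $1\le k<n$, and $\rho_n(k)=0$ for $k>n$; - $\alpha_{n+1}$ is independent of $\sigma(\mathcal F_n,\beta_{n+1})$ with $\mathbb P(\alpha_{n+1}=1)=p=1-\mathbb P(\alpha_{n+1}=-1)$. Assume the superdiffusive regime $a>(1-c)/2$. Then there is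 a square-integrable random variable $L_c$ on the same probability space such that 1. with $\Lambda_t=t^{\lambda(a+c)}L_c$, as $n\to\infty$, $$\Big(\frac{S_{\lfloor nt\rfloor}}{n^{\lambda(a+c)}},\ t\ge0\Big)\Longrightarrow(\Lambda_t,\ t\ge0)$$ in distribution in $D([0,\infty))$, the space of real right-continuous functions on $[0,\infty)$ with left-hand limits, with the Skorokhod $J_1$ topology; 2. $\displaystyle\lim_{n\to\infty}\frac{S_n}{n^{\lambda(a+c)}}=L_c$ almost surely; 3. $\displaystyle\lim_{n\to\infty}\mathbb E\Big[\Big|\frac{S_n}{n^{\lambda(a+c)}}-L_c\Big|^2\Big]=0$; 4. $L_c$ is non-degenerate (not almost surely equal to a constant), unless $p=1$ and $q\in\{0,1\}$. -/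

import Mathlib

open MeasureTheory ProbabilityTheory Filter Topology
open scoped NNReal

/-- A function on `[0, ∞)` that is right-continuous with left-hand limits. -/
def IsCadlag (f : ℝ≥0 → ℝ) : Prop :=
  ∀ t : ℝ≥0, ContinuousWithinAt f (Set.Ici t) t ∧ ∃ l : ℝ, Tendsto f (𝓝[<] t) (𝓝 l)

/-- The space `D([0, ∞))` of real functions on `[0, ∞)` that are right-continuous
with left-hand limits. -/
structure SkorokhodSpace where
  toFun : ℝ≥0 → ℝ
  isCadlag : IsCadlag toFun

namespace SkorokhodSpace

/-- The basic Skorokhod `J₁` neighbourhood of `f`: those `g` for which there is a time change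
(an increasing bijection of `[0, ∞)`) moving no time by `ε` or more, after which `g` is within `ε`
of `f` at all times up to `T`. -/
def basicNhd (f : SkorokhodSpace) (T : ℝ≥0) (ε : ℝ) : Set SkorokhodSpace :=
  {g | ∃ τ : ℝ≥0 ≃o ℝ≥0, (∀ s, |(τ s : ℝ) - (s : ℝ)| < ε) ∧
    ∀ s ≤ T, |g.toFun (τ s) - f.toFun s| < ε}

theorem basicNhd_mono (f : SkorokhodSpace) {T T' : ℝ≥0} {ε ε' : ℝ} (hT : T ≤ T') (hε : ε' ≤ ε) :
    basicNhd f T' ε' ⊆ basicNhd f T ε := by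
  rintro g ⟨τ, h1, h2⟩
  exact ⟨τ, fun s => (h1 s).trans_le hε, fun s hs => (h2 s (hs.trans hT)).trans_le hε⟩

/-- The Skorokhod `J₁` topology on `D([0, ∞))`. A sequence `gₙ` converges to `f` in it if and only
if there are time changes `τₙ` of `[0, ∞)` such that `τₙ → id` uniformly on `[0, ∞)` and
`gₙ ∘ τₙ → f` uniformly on `[0, T]` for every `T`. -/
instance : TopologicalSpace SkorokhodSpace where
  IsOpen U := ∀ f ∈ U, ∃ T : ℝ≥0, ∃ ε : ℝ, 0 < ε ∧ basicNhd f T ε ⊆ U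
  isOpen_univ := fun _ _ => ⟨0, 1, one_pos, Set.subset_univ _⟩
  isOpen_inter := by
    rintro U V hU hV f ⟨hfU, hfV⟩
    obtain ⟨T, ε, hε, h⟩ := hU f hfU
    obtain ⟨T', ε', hε', h'⟩ := hV f hfV
    exact ⟨max T T', min ε ε', lt_min hε hε', Set.subset_inter
      ((basicNhd_mono f (le_max_left _ _) (min_le_left _ _)).trans h)
      ((basicNhd_mono f (le_max_right _ _) (min_le_right _ _)).trans h')⟩
  isOpen_sUnion := by
    rintro S hS f ⟨U, hU, hf⟩
    obtain ⟨T, ε, hε, h⟩ := hS U hU f hf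
    exact ⟨T, ε, hε, h.trans (Set.subset_sUnion_of_mem hU)⟩

instance : MeasurableSpace SkorokhodSpace := borel SkorokhodSpace

instance : BorelSpace SkorokhodSpace := ⟨rfl⟩

end SkorokhodSpace

theorem isCadlag_floor (s : ℕ → ℝ) (r : ℝ) (n : ℕ) :
    IsCadlag (fun t : ℝ≥0 => s ⌊(n : ℝ≥0) * t⌋₊ / r) := by
  intro t
  have hcont : Tendsto (fun u : ℝ≥0 => (n : ℝ≥0) * u) (𝓝 t) (𝓝 ((n : ℝ≥0) * t)) :=
    (continuous_const.mul continuous_id).tendsto t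
  constructor
  · refine tendsto_const_nhds.congr' ?_
    have h1 : ∀ᶠ u in 𝓝[≥] t, (n : ℝ≥0) * u < (⌊(n : ℝ≥0) * t⌋₊ : ℝ≥0) + 1 :=
      (hcont.eventually (gt_mem_nhds (Nat.lt_floor_add_one _))).filter_mono nhdsWithin_le_nhds
    filter_upwards [h1, self_mem_nhdsWithin] with u hu hut
    have h2 : ⌊(n : ℝ≥0) * u⌋₊ = ⌊(n : ℝ≥0) * t⌋₊ := by
      rw [Nat.floor_eq_iff zero_le]
      exact ⟨(Nat.floor_le zero_le).trans (mul_le_mul_right (Set.mem_Ici.1 hut) _), hu⟩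
    rw [h2]
  · refine ⟨s (⌈(n : ℝ≥0) * t⌉₊ - 1) / r, tendsto_const_nhds.congr' ?_⟩
    rcases eq_or_ne ((n : ℝ≥0) * t) 0 with h0 | h0
    · filter_upwards [self_mem_nhdsWithin] with u hu
      have h3 : (n : ℝ≥0) * u = 0 :=
        le_antisymm (h0 ▸ mul_le_mul_right (Set.mem_Iio.1 hu).le _) zero_le
      simp [h0, h3]
    · have hpos : 0 < (n : ℝ≥0) * t := pos_iff_ne_zero.2 h0
      have hn : 0 < (n : ℝ≥0) := pos_iff_ne_zero.2 (left_ne_zero_of_mul h0)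
      have hc : 0 < ⌈(n : ℝ≥0) * t⌉₊ := Nat.ceil_pos.2 hpos
      have hk : ((⌈(n : ℝ≥0) * t⌉₊ - 1 : ℕ) : ℝ≥0) < (n : ℝ≥0) * t :=
        Nat.lt_ceil.1 (by omega)
      have h1 : ∀ᶠ u in 𝓝[<] t, ((⌈(n : ℝ≥0) * t⌉₊ - 1 : ℕ) : ℝ≥0) < (n : ℝ≥0) * u :=
        (hcont.eventually (lt_mem_nhds hk)).filter_mono nhdsWithin_le_nhds
      filter_upwards [h1, self_mem_nhdsWithin] with u hu hut
      have h2 : ⌊(n : ℝ≥0) * u⌋₊ = ⌈(n : ℝ≥0) * t⌉₊ - 1 := by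
        rw [Nat.floor_eq_iff zero_le]
        refine ⟨hu.le, ?_⟩
        have h3 : (n : ℝ≥0) * u < (n : ℝ≥0) * t := mul_lt_mul_of_pos_left (Set.mem_Iio.1 hut) hn
        have h4 : ((⌈(n : ℝ≥0) * t⌉₊ - 1 : ℕ) : ℝ≥0) + 1 = (⌈(n : ℝ≥0) * t⌉₊ : ℝ≥0) := by
          exact_mod_cast Nat.sub_add_cancel hc
        rw [h4]
        exact h3.trans_le (Nat.le_ceil _)
      rw [h2]

/-- The path `t ↦ s_{⌊n t⌋} / r`, as an element of `D([0, ∞))`. -/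
noncomputable def rescaledPath (s : ℕ → ℝ) (r : ℝ) (n : ℕ) : SkorokhodSpace where
  toFun t := s ⌊(n : ℝ≥0) * t⌋₊ / r
  isCadlag := isCadlag_floor s r n

/-- The weight `ρ_n(k)` of the instant `k` after `n` steps, when `b m` is the instant recalled
at time `m` (only `b 2, …, b n` matter). -/
noncomputable def rerwWeight (c : ℝ) (b : ℕ → ℕ) : ℕ → ℕ → ℝ
  | 0, _ => 0
  | n + 1, k =>
      if k = n + 1 then 1
      else if 1 ≤ k ∧ k ≤ n then rerwWeight c b n k + c * (if b (n + 1) = k then 1 else 0)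
      else 0

/-- The `σ`-algebra `F_n` generated by the steps `X_1, …, X_n` and by the recalled
instants `β_2, …, β_n`. -/
abbrev rerwHistory {Ω : Type*} (X : ℕ → Ω → ℝ) (β : ℕ → Ω → ℕ) (n : ℕ) : MeasurableSpace Ω :=
  (⨆ k ∈ Finset.Icc 1 n, MeasurableSpace.comap (X k) inferInstance) ⊔
    (⨆ k ∈ Finset.Icc 2 n, MeasurableSpace.comap (β k) inferInstance)

/-- `X_1, X_2, …` are the steps of a reinforced elephant random walk with memory parameter `p`,
first-step parameter `q` and reinforcement `c`, with recalled instants `β_2, β_3, …` and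
signs `α_2, α_3, …`: the values of the sequences at the unused indices are irrelevant. -/
structure IsRERW {Ω : Type*} [MeasurableSpace Ω] (μ : Measure Ω) (p q c : ℝ)
    (X : ℕ → Ω → ℝ) (α : ℕ → Ω → ℝ) (β : ℕ → Ω → ℕ) : Prop where
  measurable_step : ∀ n, Measurable (X n)
  measurable_sign : ∀ n, Measurable (α n)
  measurable_recall : ∀ n, Measurable (β n)
  first_step_right : μ.real {ω | X 1 ω = 1} = q
  first_step_left : μ.real {ω | X 1 ω = -1} = 1 - q
  sign_pos : ∀ n, 1 ≤ n → μ.real {ω | α (n + 1) ω = 1} = p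
  sign_neg : ∀ n, 1 ≤ n → μ.real {ω | α (n + 1) ω = -1} = 1 - p
  /-- The sign `α_{n+1}` is independent of the past and of the choice of `β_{n+1}`. -/
  sign_indep : ∀ n, 1 ≤ n →
    Indep (MeasurableSpace.comap (α (n + 1)) inferInstance)
      (rerwHistory X β n ⊔ MeasurableSpace.comap (β (n + 1)) inferInstance) μ
  /-- Given the past, the instant `k` is recalled with probability proportional to its weight. -/
  recall_law : ∀ n, 1 ≤ n → ∀ k ∈ Finset.Icc 1 n,
    μ⟦{ω | β (n + 1) ω = k} | rerwHistory X β n⟧ =ᵐ[μ] fun ω =>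
      rerwWeight c (fun m => β m ω) n k /
        ∑ j ∈ Finset.Icc 1 n, rerwWeight c (fun m => β m ω) n j
  step_eq : ∀ n, 1 ≤ n → ∀ᵐ ω ∂μ, X (n + 1) ω = α (n + 1) ω * X (β (n + 1) ω) ω

/-- The position `S_n = X_1 + ⋯ + X_n`, with `S_0 = 0`. -/
def rerwPosition {Ω : Type*} (X : ℕ → Ω → ℝ) (n : ℕ) (ω : Ω) : ℝ :=
  ∑ k ∈ Finset.Icc 1 n, X k ω

/-! Let `W_n = ∑ ρ_n(k) X_k` be the weighted position. Almost surely the weights sum to `1 +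
(c+1)(n-1)`, so given the past the next step has mean `a W_n / (1 + (c+1)(n-1))`, while `W` gains
`(a+c) W_n / (1 + (c+1)(n-1))` in mean: the recalled step is counted `c` times, the new one once.

Two martingales result. Divided by the deterministic product `growth`, of order `n ^ θ` with `θ =
(a+c)/(c+1)`, `W` is a martingale whose increments are `O(n ^ (-θ))`. The superdiffusive regime is
`θ > 1/2`, so these bounds are square-summable and there is an almost sure and `L²` limit `M`
(`exists_limit_weightedPosition`). With `κ = a/(a+c)`, `S - κ W` is a martingale with bounded
increments, hence `o(n ^ θ)` in both senses (`tendsto_div_rpow_zero`). Therefore `S_n / n ^ θ → κ C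
M`, where `C = lim growth / n ^ θ`.

The functional limit is pathwise: a numerical sequence equivalent to `x n ^ θ` has rescaled paths
converging locally uniformly (`tendsto_rescaledPath`). For non-degeneracy, `M` closes its
martingale, so a constant limit would make every `W_n` deterministic; three of them suffice to force
`p = 1` and `q ∈ {0, 1}` (`eq_one_of_weightedPosition_ae_const`). -/

/-- **Kronecker's lemma**. -/
theorem tendsto_div_zero_of_tendsto_sum_div {x b : ℕ → ℝ} (hpos : ∀ n, 0 < b n)
    (hmono : Monotone b) (hb : Tendsto b atTop atTop) {l : ℝ}
    (h : Tendsto (fun n => ∑ k ∈ Finset.range n, x k / b k) atTop (𝓝 l)) :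
    Tendsto (fun n => (∑ k ∈ Finset.range n, x k) / b n) atTop (𝓝 0) := by
  set T : ℕ → ℝ := fun n => ∑ k ∈ Finset.range n, x k / b k
  -- Summation by parts with partial sums centred at `l`: every term except `b 0 * l` then carries a
  -- factor tending to `0`.
  have habel : ∀ n, ∑ k ∈ Finset.range n, x k =
      b n * (T n - l) + b 0 * l - ∑ k ∈ Finset.range n, (b (k + 1) - b k) * (T (k + 1) - l) := by
    intro n
    induction n with
    | zero => simp [T]
    | succ n ih =>
      have hT : T (n + 1) = T n + x n / b n := Finset.sum_range_succ _ _
      have hx : x n = b n * (T (n + 1) - T n) := by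
        rw [hT]; field_simp [(hpos n).ne']; ring
      rw [Finset.sum_range_succ, Finset.sum_range_succ, ih, hx]; ring
  have hT : Tendsto (fun n => T n - l) atTop (𝓝 0) := by simpa using h.sub_const l
  have hinv : Tendsto (fun n => (b n)⁻¹) atTop (𝓝 0) := tendsto_inv_atTop_zero.comp hb
  have hsum : ∀ n, ∑ k ∈ Finset.range n, (b (k + 1) - b k) = b n - b 0 :=
    fun n => Finset.sum_range_sub _ _
  have ho : (fun k => (b (k + 1) - b k) * (T (k + 1) - l)) =o[atTop] fun k => b (k + 1) - b k := by
    have h1 : (fun k => T (k + 1) - l) =o[atTop] fun _ => (1 : ℝ) :=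
      (Asymptotics.isLittleO_one_iff ℝ).2 ((tendsto_add_atTop_iff_nat 1).2 hT)
    simpa using (Asymptotics.isBigO_refl (fun k => b (k + 1) - b k) atTop).mul_isLittleO h1
  -- Weighted Cesàro: the weights `b (k + 1) - b k` are nonnegative with divergent sum.
  have ho2 := ho.sum_range (fun n => sub_nonneg.2 (hmono (Nat.le_succ n))) (by
    simp_rw [hsum]; exact tendsto_atTop_add_const_right _ _ hb)
  simp_rw [hsum] at ho2
  have ho3 : (fun n => b n - b 0) =O[atTop] b := by
    refine Asymptotics.IsBigO.of_bound 1 (Eventually.of_forall fun n => ?_)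
    rw [one_mul, Real.norm_of_nonneg (sub_nonneg.2 (hmono (Nat.zero_le n))),
      Real.norm_of_nonneg (hpos n).le]
    linarith [hpos 0]
  have h3 := (ho2.trans_isBigO ho3).tendsto_div_nhds_zero
  have h4 : Tendsto (fun n => (T n - l) + b 0 * l * (b n)⁻¹ -
      (∑ k ∈ Finset.range n, (b (k + 1) - b k) * (T (k + 1) - l)) / b n) atTop (𝓝 0) := by
    simpa using (hT.add (hinv.const_mul (b 0 * l))).sub h3
  refine h4.congr fun n => ?_
  rw [habel n]
  field_simp [(hpos n).ne']

/-! ### Square-integrable martingales with bounded increments. -/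

section L2Martingale

variable {Ω : Type*} {m0 : MeasurableSpace Ω} {μ : Measure Ω}

theorem integral_sq_eq_toReal_eLpNorm_sq {g : Ω → ℝ} (hg : MemLp g 2 μ) :
    ∫ ω, g ω ^ 2 ∂μ = (eLpNorm g 2 μ).toReal ^ 2 := by
  have h0 : 0 ≤ ∫ ω, g ω ^ 2 ∂μ := integral_nonneg fun _ => sq_nonneg _
  rw [hg.eLpNorm_eq_integral_rpow_norm two_ne_zero ENNReal.ofNat_ne_top]
  simp only [ENNReal.toReal_ofNat, Real.rpow_two, Real.norm_eq_abs, sq_abs]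
  rw [ENNReal.toReal_ofReal (Real.rpow_nonneg h0 _), ← Real.rpow_two, ← Real.rpow_mul h0]
  norm_num

theorem eLpNorm_two_le_of_integral_sq_le {g : Ω → ℝ} (hg : MemLp g 2 μ) {K : ℝ}
    (hK : ∫ ω, g ω ^ 2 ∂μ ≤ K) : eLpNorm g 2 μ ≤ ENNReal.ofReal (√K) := by
  rw [integral_sq_eq_toReal_eLpNorm_sq hg] at hK
  rw [← ENNReal.ofReal_toReal hg.eLpNorm_ne_top]
  exact ENNReal.ofReal_le_ofReal (Real.le_sqrt_of_sq_le hK)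

variable {ℱ : Filtration ℕ m0} {f : ℕ → Ω → ℝ} {b : ℕ → ℝ}

theorem ae_abs_sub_le_sum
    (hb : ∀ n, ∀ᵐ ω ∂μ, |f (n + 1) ω - f n ω| ≤ b n) (n d : ℕ) :
    ∀ᵐ ω ∂μ, |f (n + d) ω - f n ω| ≤ ∑ i ∈ Finset.range d, b (n + i) := by
  induction d with
  | zero => simp
  | succ d ih =>
    filter_upwards [ih, hb (n + d)] with ω h1 h2
    rw [Finset.sum_range_succ, ← add_assoc]
    calc |f (n + d + 1) ω - f n ω| = |(f (n + d) ω - f n ω) + (f (n + d + 1) ω - f (n + d) ω)| := by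
          congr 1; ring
      _ ≤ _ := (abs_add_le _ _).trans (add_le_add h1 h2)

namespace MeasureTheory.Martingale

variable [IsProbabilityMeasure μ]

theorem memLp_sub (hf : Martingale f ℱ μ)
    (hb : ∀ n, ∀ᵐ ω ∂μ, |f (n + 1) ω - f n ω| ≤ b n) (n d : ℕ) :
    MemLp (fun ω => f (n + d) ω - f n ω) 2 μ :=
  MemLp.of_bound ((hf.integrable _).sub (hf.integrable _)).aestronglyMeasurable _
    (ae_abs_sub_le_sum hb n d)

/-- Given `ℱ (n + d)` the first factor is known and the second has mean zero. This orthogonality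
removes the cross terms when squared increments are summed. -/
theorem integral_sub_mul_sub_eq_zero (hf : Martingale f ℱ μ)
    (hb : ∀ n, ∀ᵐ ω ∂μ, |f (n + 1) ω - f n ω| ≤ b n) (n d : ℕ) :
    ∫ ω, (f (n + d) ω - f n ω) * (f (n + d + 1) ω - f (n + d) ω) ∂μ = 0 := by
  have hmeas : StronglyMeasurable[ℱ (n + d)] (f (n + d) - f n) :=
    (hf.stronglyMeasurable _).sub ((hf.stronglyMeasurable n).mono (ℱ.mono (Nat.le_add_right n d)))
  have h1 : μ[(f (n + d) - f n) * (f (n + d + 1) - f (n + d)) | ℱ (n + d)] =ᵐ[μ] 0 := by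
    refine (condExp_mul_of_stronglyMeasurable_left hmeas
      ((hf.memLp_sub hb n d).integrable_mul (hf.memLp_sub hb (n + d) 1))
      ((hf.integrable _).sub (hf.integrable _))).trans ?_
    filter_upwards [condExp_sub (m := ℱ (n + d)) (hf.integrable (n + d + 1))
      (hf.integrable (n + d)), hf.condExp_ae_eq (Nat.le_succ (n + d)),
      hf.condExp_ae_eq (le_refl (n + d))] with ω h2 h3 h4
    rw [Pi.mul_apply]
    change _ * (μ[f (n + d + 1) - f (n + d) | ℱ (n + d)]) ω = 0
    rw [h2]
    change _ * ((μ[f (n + d + 1) | ℱ (n + d)]) ω - (μ[f (n + d) | ℱ (n + d)]) ω) = 0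
    rw [h4, h3, sub_self, mul_zero]
  change ∫ ω, ((f (n + d) - f n) * (f (n + d + 1) - f (n + d))) ω ∂μ = 0
  rw [← integral_condExp (ℱ.le (n + d)), integral_congr_ae h1]
  simp

theorem integral_sub_sq_le (hf : Martingale f ℱ μ)
    (hb : ∀ n, ∀ᵐ ω ∂μ, |f (n + 1) ω - f n ω| ≤ b n) (n d : ℕ) :
    ∫ ω, (f (n + d) ω - f n ω) ^ 2 ∂μ ≤ ∑ i ∈ Finset.range d, b (n + i) ^ 2 := by
  induction d with
  | zero => simp
  | succ d ih =>
    have hA := hf.memLp_sub hb n d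
    have hB := hf.memLp_sub hb (n + d) 1
    have hle : ∫ ω, (f (n + d + 1) ω - f (n + d) ω) ^ 2 ∂μ ≤ b (n + d) ^ 2 := by
      calc _ ≤ ∫ _, b (n + d) ^ 2 ∂μ := by
            refine integral_mono_ae hB.integrable_sq (integrable_const _) ?_
            filter_upwards [hb (n + d)] with ω h
            exact sq_le_sq' (neg_le_of_abs_le h) (le_of_abs_le h)
        _ = _ := by simp
    calc ∫ ω, (f (n + (d + 1)) ω - f n ω) ^ 2 ∂μ
        = ∫ ω, ((f (n + d) ω - f n ω) ^ 2 +
            2 * ((f (n + d) ω - f n ω) * (f (n + d + 1) ω - f (n + d) ω)) +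
            (f (n + d + 1) ω - f (n + d) ω) ^ 2) ∂μ := by
          congr 1; ext ω; rw [← add_assoc]; ring
      _ = ∫ ω, (f (n + d) ω - f n ω) ^ 2 ∂μ + ∫ ω, (f (n + d + 1) ω - f (n + d) ω) ^ 2 ∂μ := by
          have hAB : Integrable (fun ω => 2 * ((f (n + d) ω - f n ω) *
              (f (n + d + 1) ω - f (n + d) ω))) μ := (MemLp.integrable_mul hA hB).const_mul 2
          have hAAB : Integrable (fun ω => (f (n + d) ω - f n ω) ^ 2 + 2 * ((f (n + d) ω - f n ω) *
              (f (n + d + 1) ω - f (n + d) ω))) μ := hA.integrable_sq.add hAB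
          rw [integral_add hAAB hB.integrable_sq,
            integral_add hA.integrable_sq hAB, integral_const_mul]
          rw [hf.integral_sub_mul_sub_eq_zero hb]; ring
      _ ≤ _ := by rw [Finset.sum_range_succ]; exact add_le_add ih hle

/-- A square-integrable martingale whose increments are bounded by a square-summable sequence
converges almost surely and in `L²`, and is closed by its limit. -/
theorem exists_tendsto_of_summable_sq (hf : Martingale f ℱ μ)
    (hb : ∀ n, ∀ᵐ ω ∂μ, |f (n + 1) ω - f n ω| ≤ b n) (hsum : Summable fun n => b n ^ 2)
    (h0 : MemLp (f 0) 2 μ) :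
    ∃ L : Ω → ℝ, Measurable L ∧ MemLp L 2 μ ∧
      (∀ᵐ ω ∂μ, Tendsto (fun n => f n ω) atTop (𝓝 (L ω))) ∧
      Tendsto (fun n => ∫ ω, (f n ω - L ω) ^ 2 ∂μ) atTop (𝓝 0) ∧
      ∀ n, f n =ᵐ[μ] μ[L | ℱ n] := by
  have hmem : ∀ n, MemLp (f n) 2 μ := fun n => by
    have := (hf.memLp_sub hb 0 n).add h0
    refine this.congr_norm (hf.integrable n).aestronglyMeasurable (ae_of_all _ fun ω => ?_)
    simp
  have htail : ∀ n d, eLpNorm (fun ω => f (n + d) ω - f n ω) 2 μ ≤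
      ENNReal.ofReal (√(∑' i, b (i + n) ^ 2)) := fun n d => by
    refine eLpNorm_two_le_of_integral_sq_le (hf.memLp_sub hb n d)
      ((hf.integral_sub_sq_le hb n d).trans ?_)
    simp_rw [add_comm n]
    exact ((summable_nat_add_iff n).2 hsum).sum_le_tsum _ fun _ _ => sq_nonneg _
  set R : ℝ≥0 := (eLpNorm (f 0) 2 μ).toNNReal + (√(∑' i, b (i + 0) ^ 2)).toNNReal
  have hR : ∀ n, eLpNorm (f n) 2 μ ≤ R := fun n => by
    calc eLpNorm (f n) 2 μ = eLpNorm (f 0 + fun ω => f (0 + n) ω - f 0 ω) 2 μ := by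
          congr 1; ext ω; simp
      _ ≤ _ := eLpNorm_add_le h0.1 (hf.memLp_sub hb 0 n).1 one_le_two
      _ ≤ R := by
          rw [ENNReal.coe_add, ENNReal.coe_toNNReal h0.eLpNorm_ne_top]
          exact add_le_add le_rfl (htail 0 n)
  have hR1 : ∀ n, eLpNorm (f n) 1 μ ≤ R := fun n =>
    (eLpNorm_le_eLpNorm_of_exponent_le one_le_two (hmem n).1).trans (hR n)
  obtain ⟨L, hLmeas, hlim⟩ := exists_stronglyMeasurable_limit_of_tendsto_ae
    (fun n => (hmem n).1) (hf.submartingale.exists_ae_tendsto_of_bdd hR1)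
  have hL : MemLp L 2 μ := ⟨hLmeas.aestronglyMeasurable,
    ((Lp.eLpNorm_lim_le_liminf_eLpNorm (fun n => (hmem n).1) L hlim).trans
      (liminf_le_of_frequently_le' (Frequently.of_forall hR))).trans_lt ENNReal.coe_lt_top⟩
  -- Fatou as `d → ∞`: the bound on `f (n + d) - f n` is uniform in `d`, so it passes to `L - f n`.
  have hLe : ∀ n, eLpNorm (f n - L) 2 μ ≤ ENNReal.ofReal (√(∑' i, b (i + n) ^ 2)) := fun n => by
    rw [eLpNorm_sub_comm]
    refine (Lp.eLpNorm_lim_le_liminf_eLpNorm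
      (f := fun d ω => f (n + d) ω - f n ω) (fun d => (hf.memLp_sub hb n d).1) (L - f n) ?_).trans ?_
    · filter_upwards [hlim] with ω hω
      have h2 : Tendsto (fun d => f (n + d) ω) atTop (𝓝 (L ω)) := by
        simp_rw [add_comm n]; exact (tendsto_add_atTop_iff_nat n).2 hω
      exact h2.sub_const _
    · exact liminf_le_of_frequently_le' (Frequently.of_forall (htail n))
  have hto : Tendsto (fun n => eLpNorm (f n - L) 2 μ) atTop (𝓝 0) := by
    refine tendsto_of_tendsto_of_tendsto_of_le_of_le tendsto_const_nhds ?_ (fun _ => zero_le) hLe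
    have h3 := (tendsto_sum_nat_add fun n => b n ^ 2).sqrt
    simpa using (ENNReal.tendsto_ofReal h3)
  refine ⟨L, hLmeas.measurable, hL, hlim, ?_, ?_⟩
  · have h4 := ((ENNReal.tendsto_toReal ENNReal.zero_ne_top).comp hto).pow 2
    simp only [ENNReal.toReal_zero, ne_eq, OfNat.ofNat_ne_zero, not_false_eq_true, zero_pow] at h4
    refine h4.congr fun n => ?_
    exact (integral_sq_eq_toReal_eLpNorm_sq ((hmem n).sub hL)).symm
  · refine hf.eq_condExp_of_tendsto_eLpNorm (hL.integrable one_le_two) ?_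
    refine tendsto_of_tendsto_of_tendsto_of_le_of_le tendsto_const_nhds hto (fun _ => zero_le)
      fun n => eLpNorm_le_eLpNorm_of_exponent_le one_le_two ((hmem n).sub hL).1

/-- A martingale transform by deterministic weights; with `w k = 1 / b k` it is the series that
Kronecker's lemma requires. -/
theorem martingale_sum_mul_sub (hf : Martingale f ℱ μ) (w : ℕ → ℝ) :
    Martingale (fun n ω => ∑ k ∈ Finset.range n, w k * (f (k + 1) ω - f k ω)) ℱ μ := by
  have hint : ∀ k, Integrable (fun ω => w k * (f (k + 1) ω - f k ω)) μ := fun k =>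
    ((hf.integrable _).sub (hf.integrable _)).const_mul _
  refine martingale_of_condExp_sub_eq_zero_nat (fun n => ?_)
    (fun n => integrable_finsetSum _ fun k _ => hint k) fun n => ?_
  · refine Finset.stronglyMeasurable_fun_sum _ fun k hk => ?_
    have hk' := Finset.mem_range.1 hk
    exact (((hf.stronglyMeasurable (k + 1)).mono (ℱ.mono hk')).sub
      ((hf.stronglyMeasurable k).mono (ℱ.mono hk'.le))).const_mul _
  · have h1 : ((fun ω => ∑ k ∈ Finset.range (n + 1), w k * (f (k + 1) ω - f k ω)) -
        fun ω => ∑ k ∈ Finset.range n, w k * (f (k + 1) ω - f k ω)) =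
        w n • (f (n + 1) - f n) := by
      ext ω
      simp [Finset.sum_range_succ]
    rw [h1]
    filter_upwards [condExp_smul (μ := μ) (w n) (f (n + 1) - f n) (ℱ n),
      condExp_sub (m := ℱ n) (hf.integrable (n + 1)) (hf.integrable n),
      hf.condExp_ae_eq (Nat.le_add_right n 1), hf.condExp_ae_eq (le_refl n)] with ω h2 h3 h4 h5
    rw [h2, Pi.smul_apply, h3, Pi.sub_apply, h4, h5]
    simp

/-- A martingale with bounded increments is negligible with respect to `n ^ θ`, `θ > 1 / 2`. -/
theorem tendsto_div_rpow_zero (hf : Martingale f ℱ μ) {K θ : ℝ}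
    (hK : ∀ n, ∀ᵐ ω ∂μ, |f (n + 1) ω - f n ω| ≤ K) (h0 : MemLp (f 0) 2 μ) (hθ : 1 / 2 < θ) :
    (∀ᵐ ω ∂μ, Tendsto (fun n : ℕ => f n ω / ((n + 1 : ℕ) : ℝ) ^ θ) atTop (𝓝 0)) ∧
      Tendsto (fun n : ℕ => ∫ ω, (f n ω / ((n + 1 : ℕ) : ℝ) ^ θ) ^ 2 ∂μ) atTop (𝓝 0) := by
  set b : ℕ → ℝ := fun n => ((n + 1 : ℕ) : ℝ) ^ θ
  have hbpos : ∀ n, 0 < b n := fun n => Real.rpow_pos_of_pos (by positivity) _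
  have hbmono : Monotone b := fun i j hij =>
    Real.rpow_le_rpow (by positivity) (by exact_mod_cast Nat.succ_le_succ hij) (by linarith)
  have hcast : Tendsto (fun n : ℕ => ((n + 1 : ℕ) : ℝ)) atTop atTop :=
    tendsto_natCast_atTop_atTop.comp (tendsto_add_atTop_nat 1)
  have hbtop : Tendsto b atTop atTop := (tendsto_rpow_atTop (by linarith)).comp hcast
  have hbsq : ∀ n, b n ^ 2 = ((n + 1 : ℕ) : ℝ) ^ (2 * θ) := fun n => by
    rw [mul_comm, Real.rpow_mul (by positivity), Real.rpow_two]
  constructor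
  -- The increments of this transform are bounded by `K / b n`, square-summable because `2 * θ > 1`.
  · have hg := hf.martingale_sum_mul_sub fun k => (b k)⁻¹
    obtain ⟨L, -, -, hL, -⟩ := hg.exists_tendsto_of_summable_sq (b := fun n => (b n)⁻¹ * K)
      (fun n => by
        filter_upwards [hK n] with ω hω
        rw [Finset.sum_range_succ, add_sub_cancel_left, abs_mul, abs_of_pos (inv_pos.2 (hbpos n))]
        exact mul_le_mul_of_nonneg_left hω (inv_pos.2 (hbpos n)).le)
      (by
        simp_rw [mul_pow, inv_pow, hbsq]
        refine Summable.mul_right _ ?_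
        exact (summable_nat_add_iff 1).2 (Real.summable_nat_rpow_inv.2 (by linarith)))
      (by simp)
    filter_upwards [hL] with ω hω
    have h1 := tendsto_div_zero_of_tendsto_sum_div (x := fun k => f (k + 1) ω - f k ω)
      hbpos hbmono hbtop (l := L ω) (hω.congr fun n => Finset.sum_congr rfl fun k _ => by
        rw [div_eq_inv_mul])
    have h2 : Tendsto (fun n => f 0 ω * (b n)⁻¹) atTop (𝓝 (f 0 ω * 0)) :=
      (tendsto_inv_atTop_zero.comp hbtop).const_mul _
    rw [mul_zero] at h2
    have h3 := h1.add h2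
    rw [add_zero] at h3
    refine h3.congr fun n => ?_
    rw [Finset.sum_range_sub (fun k => f k ω) n]
    change _ = f n ω / b n
    field_simp
    ring
  -- By orthogonality the second moment of `f n` is at most `C * (n + 1)`, which `(n + 1) ^ (2 * θ)`
  -- outgrows.
  · set C := 2 * K ^ 2 + 2 * ∫ ω, f 0 ω ^ 2 ∂μ
    have hI0 : 0 ≤ ∫ ω, f 0 ω ^ 2 ∂μ := integral_nonneg fun _ => sq_nonneg _
    have hup : Tendsto (fun n : ℕ => C * ((n + 1 : ℕ) : ℝ) ^ (-(2 * θ - 1))) atTop (𝓝 (C * 0)) :=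
      ((tendsto_rpow_neg_atTop (by linarith)).comp hcast).const_mul _
    rw [mul_zero] at hup
    refine tendsto_of_tendsto_of_tendsto_of_le_of_le tendsto_const_nhds hup
      (fun n => integral_nonneg fun _ => sq_nonneg _) fun n => ?_
    have hA : MemLp (fun ω => f n ω - f 0 ω) 2 μ := by simpa using hf.memLp_sub hK 0 n
    have hA2 : ∫ ω, (f n ω - f 0 ω) ^ 2 ∂μ ≤ n * K ^ 2 := by
      simpa using hf.integral_sub_sq_le hK 0 n
    have hn1 : (0 : ℝ) < ((n + 1 : ℕ) : ℝ) := by positivity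
    calc ∫ ω, (f n ω / b n) ^ 2 ∂μ
        ≤ ∫ ω, (b n ^ 2)⁻¹ * (2 * (f n ω - f 0 ω) ^ 2 + 2 * f 0 ω ^ 2) ∂μ := by
          refine integral_mono_of_nonneg (ae_of_all _ fun _ => sq_nonneg _)
            (((hA.integrable_sq.const_mul 2).add (h0.integrable_sq.const_mul 2)).const_mul _)
            (ae_of_all _ fun ω => ?_)
          change (f n ω / b n) ^ 2 ≤ (b n ^ 2)⁻¹ * (2 * (f n ω - f 0 ω) ^ 2 + 2 * f 0 ω ^ 2)
          rw [div_pow, div_eq_inv_mul]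
          refine mul_le_mul_of_nonneg_left ?_ (inv_nonneg.2 (sq_nonneg _))
          nlinarith [sq_nonneg (f n ω - f 0 ω - f 0 ω)]
      _ = (b n ^ 2)⁻¹ * (2 * ∫ ω, (f n ω - f 0 ω) ^ 2 ∂μ + 2 * ∫ ω, f 0 ω ^ 2 ∂μ) := by
          rw [integral_const_mul, integral_add (hA.integrable_sq.const_mul 2)
            (h0.integrable_sq.const_mul 2), integral_const_mul, integral_const_mul]
      _ ≤ (b n ^ 2)⁻¹ * (C * ((n + 1 : ℕ) : ℝ)) := by
          refine mul_le_mul_of_nonneg_left ?_ (inv_nonneg.2 (sq_nonneg _))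
          push_cast
          simp only [C]
          nlinarith [mul_nonneg (n.cast_nonneg (α := ℝ)) hI0, sq_nonneg K]
      _ = _ := by
          rw [hbsq, neg_sub, Real.rpow_sub hn1, Real.rpow_one]
          field_simp

end MeasureTheory.Martingale

end L2Martingale

/-! ### Locally uniform convergence of paths in `D([0, ∞))`. -/

theorem SkorokhodSpace.tendsto_of_tendsto_uniform {ι : Type*} {l : Filter ι}
    {g : ι → SkorokhodSpace} {f : SkorokhodSpace}
    (h : ∀ T : ℝ≥0, ∀ ε : ℝ, 0 < ε → ∀ᶠ i in l, ∀ s ≤ T, |(g i).toFun s - f.toFun s| < ε) :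
    Tendsto g l (𝓝 f) := by
  rw [tendsto_nhds]
  intro U hU hf
  obtain ⟨T, ε, hε, hsub⟩ := hU f hf
  filter_upwards [h T ε hε] with i hi
  exact hsub ⟨OrderIso.refl _, fun s => by simpa using hε, hi⟩

/-- On `[0, T]` the path reads only the finitely many coordinates up to `⌊n T⌋`, so the product
topology is enough. Continuity serves to make the rescaled walk measurable in `D([0, ∞))`. -/
theorem continuous_rescaledPath (r : ℝ) (n : ℕ) :
    Continuous fun s : ℕ → ℝ => rescaledPath s r n := by
  rw [continuous_iff_continuousAt]
  intro s
  refine SkorokhodSpace.tendsto_of_tendsto_uniform fun T ε hε => ?_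
  have h1 : ∀ k ∈ Finset.range (⌊(n : ℝ≥0) * T⌋₊ + 1),
      ∀ᶠ s' in 𝓝 s, |s' k / r - s k / r| < ε := fun k _ => by
    have h2 : Tendsto (fun s' : ℕ → ℝ => |s' k / r - s k / r|) (𝓝 s) (𝓝 |s k / r - s k / r|) :=
      Continuous.tendsto (by fun_prop) s
    exact h2.eventually (gt_mem_nhds (by simpa using hε))
  filter_upwards [(Filter.eventually_all_finset _).2 h1] with s' hs' t ht
  refine hs' _ (Finset.mem_range.2 (Nat.lt_succ_of_le (Nat.floor_mono ?_)))
  gcongr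

/-- The path `t ↦ t ^ θ * x`, as an element of `D([0, ∞))`. -/
noncomputable def powerPath (θ : ℝ) (hθ : 0 ≤ θ) (x : ℝ) : SkorokhodSpace where
  toFun t := (t : ℝ) ^ θ * x
  isCadlag t := by
    have h : Continuous fun t : ℝ≥0 => (t : ℝ) ^ θ * x :=
      (NNReal.continuous_coe.rpow_const fun _ => Or.inr hθ).mul continuous_const
    exact ⟨h.continuousWithinAt, _, h.continuousWithinAt⟩

theorem continuous_powerPath (θ : ℝ) (hθ : 0 ≤ θ) : Continuous (powerPath θ hθ) := by
  rw [continuous_iff_continuousAt]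
  intro x
  refine SkorokhodSpace.tendsto_of_tendsto_uniform fun T ε hε => ?_
  have h2 : Tendsto (fun y : ℝ => (T : ℝ) ^ θ * |y - x|) (𝓝 x) (𝓝 ((T : ℝ) ^ θ * |x - x|)) :=
    Continuous.tendsto (by fun_prop) x
  filter_upwards [h2.eventually (gt_mem_nhds (by simpa using hε))] with y hy t ht
  refine lt_of_le_of_lt ?_ hy
  change |(t : ℝ) ^ θ * y - (t : ℝ) ^ θ * x| ≤ _
  rw [← mul_sub, abs_mul, abs_of_nonneg (Real.rpow_nonneg t.coe_nonneg θ)]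
  gcongr

/-- If `s_n / n ^ θ → x`, the rescaled paths of `s` converge to `t ↦ t ^ θ * x`. -/
theorem tendsto_rescaledPath {s : ℕ → ℝ} {θ x : ℝ} (hθ : 0 < θ) (hθ1 : θ ≤ 1)
    (h : Tendsto (fun n : ℕ => s n / (n : ℝ) ^ θ) atTop (𝓝 x)) :
    Tendsto (fun n : ℕ => rescaledPath s ((n : ℝ) ^ θ) n) atTop (𝓝 (powerPath θ hθ.le x)) := by
  refine SkorokhodSpace.tendsto_of_tendsto_uniform fun T ε hε => ?_
  set δ : ℝ := ε / 2 / ((T : ℝ) ^ θ + 1)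
  have hT : 0 ≤ (T : ℝ) ^ θ := Real.rpow_nonneg T.2 _
  have hδ : 0 < δ := by positivity
  obtain ⟨N, hN⟩ := Metric.tendsto_atTop.1 h δ hδ
  -- The constant `C` absorbs the indices `k ≤ N`, including `0`. The bound thus holds for every
  -- `k`, which gives uniformity down to `t = 0`, where `⌊n t⌋` stays small.
  obtain ⟨C, hC0, hC⟩ : ∃ C : ℝ, 0 ≤ C ∧ ∀ k : ℕ, |s k - (k : ℝ) ^ θ * x| ≤ δ * (k : ℝ) ^ θ + C := by
    refine ⟨∑ k ∈ Finset.range (N + 1), |s k - (k : ℝ) ^ θ * x|,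
      Finset.sum_nonneg fun _ _ => abs_nonneg _, fun k => ?_⟩
    have hk0 : 0 ≤ (k : ℝ) ^ θ := Real.rpow_nonneg k.cast_nonneg _
    rcases lt_or_ge k (N + 1) with hk | hk
    · have := Finset.single_le_sum (f := fun k : ℕ => |s k - (k : ℝ) ^ θ * x|)
        (fun _ _ => abs_nonneg _) (Finset.mem_range.2 hk)
      have h5 : 0 ≤ δ * (k : ℝ) ^ θ := by positivity
      linarith
    · have hk1 : 0 < (k : ℝ) ^ θ := Real.rpow_pos_of_pos (by exact_mod_cast (by omega : 0 < k)) _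
      have h6 := (hN k (by omega)).le
      rw [Real.dist_eq] at h6
      have h7 : s k - (k : ℝ) ^ θ * x = (k : ℝ) ^ θ * (s k / (k : ℝ) ^ θ - x) := by
        field_simp
      have h8 : 0 ≤ ∑ k ∈ Finset.range (N + 1), |s k - (k : ℝ) ^ θ * x| :=
        Finset.sum_nonneg fun _ _ => abs_nonneg _
      rw [h7, abs_mul, abs_of_pos hk1]
      nlinarith
  have hdec : Tendsto (fun n : ℕ => (C + |x|) * ((n : ℝ) ^ θ)⁻¹) atTop (𝓝 ((C + |x|) * 0)) :=
    (tendsto_inv_atTop_zero.comp ((tendsto_rpow_atTop hθ).comp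
      tendsto_natCast_atTop_atTop)).const_mul _
  rw [mul_zero] at hdec
  filter_upwards [hdec.eventually (gt_mem_nhds (half_pos hε)), eventually_gt_atTop 0]
    with n hn hn0 t ht
  change |s ⌊(n : ℝ≥0) * t⌋₊ / (n : ℝ) ^ θ - (t : ℝ) ^ θ * x| < ε
  set k := ⌊(n : ℝ≥0) * t⌋₊
  have hnpos : (0 : ℝ) < n := by exact_mod_cast hn0
  have hr : 0 < (n : ℝ) ^ θ := Real.rpow_pos_of_pos hnpos _
  have hk1 : (k : ℝ) ≤ n * t := by exact_mod_cast Nat.floor_le (zero_le : 0 ≤ (n : ℝ≥0) * t)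
  have hk2 : (n : ℝ) * t ≤ k + 1 := by exact_mod_cast (Nat.lt_floor_add_one ((n : ℝ≥0) * t)).le
  have hnt : ((n : ℝ) * t) ^ θ = (n : ℝ) ^ θ * (t : ℝ) ^ θ := Real.mul_rpow hnpos.le t.2
  have hkt : (k : ℝ) ^ θ ≤ (n : ℝ) ^ θ * (t : ℝ) ^ θ :=
    hnt ▸ Real.rpow_le_rpow k.cast_nonneg hk1 hθ.le
  -- Since `θ ≤ 1`, the power is subadditive, and rounding `n t` down costs at most `1`.
  have htk : (n : ℝ) ^ θ * (t : ℝ) ^ θ ≤ (k : ℝ) ^ θ + 1 := by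
    rw [← hnt]
    refine (Real.rpow_le_rpow (mul_nonneg hnpos.le t.2) hk2 hθ.le).trans ?_
    simpa using Real.rpow_add_le_add_rpow k.cast_nonneg zero_le_one hθ.le hθ1
  have htT : (t : ℝ) ^ θ ≤ (T : ℝ) ^ θ := Real.rpow_le_rpow t.2 (by exact_mod_cast ht) hθ.le
  have e1 : |s k - (n : ℝ) ^ θ * (t : ℝ) ^ θ * x| ≤ δ * ((n : ℝ) ^ θ * (T : ℝ) ^ θ) + (C + |x|) := by
    calc |s k - (n : ℝ) ^ θ * (t : ℝ) ^ θ * x|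
        = |(s k - (k : ℝ) ^ θ * x) - ((n : ℝ) ^ θ * (t : ℝ) ^ θ - (k : ℝ) ^ θ) * x| := by
          congr 1; ring
      _ ≤ |s k - (k : ℝ) ^ θ * x| + |((n : ℝ) ^ θ * (t : ℝ) ^ θ - (k : ℝ) ^ θ) * x| := abs_sub _ _
      _ ≤ (δ * (k : ℝ) ^ θ + C) + 1 * |x| := by
          refine add_le_add (hC k) ?_
          rw [abs_mul, abs_of_nonneg (sub_nonneg.2 hkt)]
          gcongr
          linarith
      _ ≤ _ := by
          have : (k : ℝ) ^ θ ≤ (n : ℝ) ^ θ * (T : ℝ) ^ θ := hkt.trans (by gcongr)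
          have := mul_le_mul_of_nonneg_left this hδ.le
          linarith
  have e2 : s k / (n : ℝ) ^ θ - (t : ℝ) ^ θ * x =
      (s k - (n : ℝ) ^ θ * (t : ℝ) ^ θ * x) * ((n : ℝ) ^ θ)⁻¹ := by field_simp
  rw [e2, abs_mul, abs_of_pos (inv_pos.2 hr)]
  have e3 : δ * (T : ℝ) ^ θ ≤ ε / 2 := by
    have : δ * ((T : ℝ) ^ θ + 1) = ε / 2 := by
      simp only [δ]; field_simp
    linarith
  calc _ ≤ (δ * ((n : ℝ) ^ θ * (T : ℝ) ^ θ) + (C + |x|)) * ((n : ℝ) ^ θ)⁻¹ := by gcongr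
    _ = δ * (T : ℝ) ^ θ + (C + |x|) * ((n : ℝ) ^ θ)⁻¹ := by field_simp
    _ < ε := by linarith

/-! ### Asymptotics of products through the Gamma function. -/

theorem prod_range_div_eq_GammaSeq {r s : ℝ} (hr : 0 < r) (hs : 0 < s) {m : ℕ} (hm : 0 < m) :
    ∏ j ∈ Finset.range (m + 1), (s + j) / (r + j) =
      (m : ℝ) ^ (s - r) * (Real.GammaSeq r m / Real.GammaSeq s m) := by
  have hm' : (0 : ℝ) < m := by exact_mod_cast hm
  have h1 : 0 < ∏ j ∈ Finset.range (m + 1), (s + j) := Finset.prod_pos fun j _ => by positivity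
  have h2 : 0 < ∏ j ∈ Finset.range (m + 1), (r + j) := Finset.prod_pos fun j _ => by positivity
  have h3 : (0 : ℝ) < m.factorial := by exact_mod_cast m.factorial_pos
  have h4 : 0 < (m : ℝ) ^ s := Real.rpow_pos_of_pos hm' _
  have h5 : 0 < (m : ℝ) ^ r := Real.rpow_pos_of_pos hm' _
  rw [Finset.prod_div_distrib, Real.GammaSeq, Real.GammaSeq, Real.rpow_sub hm']
  field_simp

theorem tendsto_prod_range_div_rpow {r s : ℝ} (hr : 0 < r) (hs : 0 < s) :
    Tendsto (fun m : ℕ => (∏ j ∈ Finset.range m, (s + j) / (r + j)) / ((m + 1 : ℕ) : ℝ) ^ (s - r))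
      atTop (𝓝 (Real.Gamma r / Real.Gamma s)) := by
  rw [← tendsto_add_atTop_iff_nat 1]
  -- After the index shift the normalisation is `(m + 2) ^ (s - r)`, whereas Euler's sequences
  -- produce `m ^ (s - r)`.
  have h1 : Tendsto (fun m : ℕ => ((m : ℝ) / (m + 2)) ^ (s - r)) atTop (𝓝 (1 ^ (s - r))) := by
    refine Tendsto.rpow_const ?_ (Or.inl one_ne_zero)
    exact_mod_cast tendsto_natCast_div_add_atTop (𝕜 := ℝ) 2
  rw [Real.one_rpow] at h1
  have h2 := h1.mul ((Real.GammaSeq_tendsto_Gamma r).div (Real.GammaSeq_tendsto_Gamma s)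
    (Real.Gamma_pos_of_pos hs).ne')
  rw [one_mul] at h2
  refine h2.congr' ?_
  filter_upwards [eventually_gt_atTop 0] with m hm
  rw [prod_range_div_eq_GammaSeq hr hs hm, Real.div_rpow (by positivity) (by positivity)]
  have : ((m + 1 + 1 : ℕ) : ℝ) = m + 2 := by push_cast; ring
  rw [this]
  simp only [Pi.div_apply]
  ring

/-! ### Deterministic identities for the recall weights. -/

section Weights

variable {c : ℝ} {b : ℕ → ℕ}

theorem rerwWeight_succ_self (n : ℕ) : rerwWeight c b (n + 1) (n + 1) = 1 := by
  simp [rerwWeight]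

theorem rerwWeight_succ_of_mem {n k : ℕ} (hk : k ∈ Finset.Icc 1 n) :
    rerwWeight c b (n + 1) k = rerwWeight c b n k + c * (if b (n + 1) = k then 1 else 0) := by
  have h := Finset.mem_Icc.1 hk
  rw [rerwWeight, if_neg (by omega), if_pos h]

theorem one_le_rerwWeight (hc : 0 ≤ c) (n : ℕ) : ∀ k ∈ Finset.Icc 1 n, 1 ≤ rerwWeight c b n k := by
  induction n with
  | zero => simp
  | succ n ih =>
    intro k hk
    rcases Nat.lt_or_ge n k with h | h
    · obtain rfl : k = n + 1 := by have := Finset.mem_Icc.1 hk; omega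
      rw [rerwWeight_succ_self]
    · have hk' : k ∈ Finset.Icc 1 n := Finset.mem_Icc.2 ⟨(Finset.mem_Icc.1 hk).1, h⟩
      rw [rerwWeight_succ_of_mem hk']
      have h1 := ih k hk'
      have : 0 ≤ c * (if b (n + 1) = k then 1 else 0) := by positivity
      linarith

theorem sum_rerwWeight_pos (hc : 0 ≤ c) {n : ℕ} (hn : 1 ≤ n) :
    0 < ∑ j ∈ Finset.Icc 1 n, rerwWeight c b n j :=
  Finset.sum_pos (fun k hk => one_pos.trans_le (one_le_rerwWeight hc n k hk))
    ⟨1, Finset.mem_Icc.2 ⟨le_rfl, hn⟩⟩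

/-- Taking `x = 1` gives the recursion of the total weight, taking `x k = X k ω` that of the
weighted position. -/
theorem sum_rerwWeight_succ_mul {n : ℕ} (hb : b (n + 1) ∈ Finset.Icc 1 n) (x : ℕ → ℝ) :
    ∑ k ∈ Finset.Icc 1 (n + 1), rerwWeight c b (n + 1) k * x k =
      ∑ k ∈ Finset.Icc 1 n, rerwWeight c b n k * x k + c * x (b (n + 1)) + x (n + 1) := by
  rw [Finset.sum_Icc_succ_top (by omega), rerwWeight_succ_self, one_mul]
  congr 1
  calc ∑ k ∈ Finset.Icc 1 n, rerwWeight c b (n + 1) k * x k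
      = ∑ k ∈ Finset.Icc 1 n, (rerwWeight c b n k * x k + if b (n + 1) = k then c * x k else 0) :=
        Finset.sum_congr rfl fun k hk => by
          rw [rerwWeight_succ_of_mem hk]
          split_ifs <;> ring
    _ = _ := by rw [Finset.sum_add_distrib, Finset.sum_ite_eq, if_pos hb]

end Weights

/-! ### Random variables with values `±1`, and constant ones. -/

section TwoValued

variable {Ω : Type*} [MeasurableSpace Ω] {μ : Measure Ω} [IsProbabilityMeasure μ] {f : Ω → ℝ}

theorem ae_eq_one_or_eq_neg_one (hf : Measurable f) {x : ℝ}
    (h1 : μ.real {ω | f ω = 1} = x) (h2 : μ.real {ω | f ω = -1} = 1 - x) :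
    ∀ᵐ ω ∂μ, f ω = 1 ∨ f ω = -1 := by
  have hm1 : MeasurableSet {ω | f ω = 1} := hf (measurableSet_singleton 1)
  have hm2 : MeasurableSet {ω | f ω = -1} := hf (measurableSet_singleton (-1))
  have hd : Disjoint {ω | f ω = 1} {ω | f ω = -1} := by
    rw [Set.disjoint_left]
    intro ω h3 h4
    have h5 : (1 : ℝ) = -1 := (show f ω = 1 from h3).symm.trans h4
    norm_num at h5
  have h3 : μ.real ({ω | f ω = 1} ∪ {ω | f ω = -1}) = 1 := by
    rw [measureReal_union hd hm2, h1, h2]; ring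
  have h4 : μ ({ω | f ω = 1} ∪ {ω | f ω = -1})ᶜ = 0 :=
    (prob_compl_eq_zero_iff (hm1.union hm2)).2 (by
      rw [← ENNReal.toReal_eq_one_iff]; exact h3)
  exact h4

theorem integral_of_ae_eq_one_or_eq_neg_one (hf : Measurable f) {x : ℝ}
    (h1 : μ.real {ω | f ω = 1} = x) (h2 : μ.real {ω | f ω = -1} = 1 - x) :
    ∫ ω, f ω ∂μ = 2 * x - 1 := by
  have hm1 : MeasurableSet {ω | f ω = 1} := hf (measurableSet_singleton 1)
  have h3 : f =ᵐ[μ] fun ω => 2 * ({ω | f ω = 1}.indicator (fun _ => (1 : ℝ)) ω) - 1 := by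
    filter_upwards [ae_eq_one_or_eq_neg_one hf h1 h2] with ω hω
    by_cases h : f ω = 1
    · simp [h]; norm_num
    · have := hω.resolve_left h
      rw [Set.indicator_of_notMem (show ω ∉ {ω | f ω = 1} from h), this]; norm_num
  rw [integral_congr_ae h3, integral_sub
    (((integrable_const _).indicator hm1).const_mul 2) (integrable_const _), integral_const_mul,
    integral_indicator_const _ hm1, h1]
  simp

theorem measureReal_eq_of_ae_eq_const {y : ℝ} (h : ∀ᵐ ω ∂μ, f ω = y) (z : ℝ) :
    μ.real {ω | f ω = z} = if y = z then 1 else 0 := by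
  split_ifs with hyz
  · have : {ω | f ω = z} =ᵐ[μ] Set.univ := by
      rw [eventuallyEq_univ]
      filter_upwards [h] with ω hω
      exact hω.trans hyz
    rw [measureReal_congr this]; simp
  · have : {ω | f ω = z} =ᵐ[μ] (∅ : Set Ω) := by
      rw [eventuallyEq_empty]
      filter_upwards [h] with ω hω hz
      exact hyz (hω.symm.trans hz)
    rw [measureReal_congr this]; simp

end TwoValued

/-! ### The history `σ`-algebras and the weighted position. -/

section History

variable {Ω : Type*} {X : ℕ → Ω → ℝ} {β : ℕ → Ω → ℕ} {n k : ℕ}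

/-- The `σ`-algebra generated by the history up to `n` and the instant recalled at time `n + 1`. -/
abbrev rerwRecallHistory (X : ℕ → Ω → ℝ) (β : ℕ → Ω → ℕ) (n : ℕ) : MeasurableSpace Ω :=
  rerwHistory X β n ⊔ MeasurableSpace.comap (β (n + 1)) inferInstance

theorem rerwHistory_mono : Monotone (rerwHistory X β) := fun _ _ hij =>
  sup_le_sup
    (iSup₂_le fun k hk => le_iSup₂_of_le k (Finset.Icc_subset_Icc_right hij hk) le_rfl)
    (iSup₂_le fun k hk => le_iSup₂_of_le k (Finset.Icc_subset_Icc_right hij hk) le_rfl)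

theorem measurable_step_rerwHistory (hk : k ∈ Finset.Icc 1 n) :
    Measurable[rerwHistory X β n] (X k) := by
  refine measurable_iff_comap_le.2 (le_trans ?_ le_sup_left)
  exact le_iSup₂_of_le k hk le_rfl

theorem measurable_recall_rerwHistory (hk : k ∈ Finset.Icc 2 n) :
    Measurable[rerwHistory X β n] (β k) := by
  refine measurable_iff_comap_le.2 (le_trans ?_ le_sup_right)
  exact le_iSup₂_of_le k hk le_rfl

theorem measurable_rerwWeight (c : ℝ) (n k : ℕ) :
    Measurable[rerwHistory X β n] fun ω => rerwWeight c (fun m => β m ω) n k := by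
  induction n with
  | zero => simp only [rerwWeight]; exact measurable_const
  | succ n ih =>
    simp only [rerwWeight]
    split_ifs with h1 h2
    · exact measurable_const
    · have h3 : Measurable[rerwHistory X β (n + 1)] (β (n + 1)) :=
        measurable_recall_rerwHistory (Finset.mem_Icc.2 ⟨by omega, le_rfl⟩)
      refine (ih.mono (rerwHistory_mono (Nat.le_succ n)) le_rfl).add (measurable_const.mul ?_)
      exact Measurable.ite (h3 (measurableSet_singleton k)) measurable_const measurable_const
    · exact measurable_const

/-- The weighted position `∑_{k ≤ n} ρ_n(k) X_k`. -/
noncomputable def rerwWeightedPosition (c : ℝ) (X : ℕ → Ω → ℝ) (β : ℕ → Ω → ℕ) (n : ℕ) (ω : Ω) :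
    ℝ :=
  ∑ k ∈ Finset.Icc 1 n, rerwWeight c (fun m => β m ω) n k * X k ω

theorem measurable_rerwWeightedPosition (c : ℝ) (n : ℕ) :
    Measurable[rerwHistory X β n] (rerwWeightedPosition c X β n) :=
  Finset.measurable_fun_sum _ fun k hk =>
    (measurable_rerwWeight c n k).mul (measurable_step_rerwHistory hk)

theorem measurable_rerwPosition_rerwHistory (n : ℕ) :
    Measurable[rerwHistory X β n] (rerwPosition X n) :=
  Finset.measurable_fun_sum _ fun _ hk => measurable_step_rerwHistory hk

theorem rerwPosition_succ (n : ℕ) (ω : Ω) :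
    rerwPosition X (n + 1) ω = rerwPosition X n ω + X (n + 1) ω :=
  Finset.sum_Icc_succ_top (by omega) _

end History

/-! ### One-step conditional expectations of the walk. -/

namespace IsRERW

variable {Ω : Type*} [mΩ : MeasurableSpace Ω] {μ : Measure Ω} {p q c : ℝ}
  {X : ℕ → Ω → ℝ} {α : ℕ → Ω → ℝ} {β : ℕ → Ω → ℕ}

theorem rerwHistory_le (hX : IsRERW μ p q c X α β) (n : ℕ) : rerwHistory X β n ≤ mΩ :=
  sup_le (iSup₂_le fun k _ => (hX.measurable_step k).comap_le)
    (iSup₂_le fun k _ => (hX.measurable_recall k).comap_le)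

/-- The filtration `(F_{n+1})` of the walk. -/
def filtration (hX : IsRERW μ p q c X α β) : Filtration ℕ mΩ where
  seq n := rerwHistory X β (n + 1)
  mono' _ _ hij := rerwHistory_mono (Nat.succ_le_succ hij)
  le' n := hX.rerwHistory_le (n + 1)

theorem measurableSet_recall_eq (hX : IsRERW μ p q c X α β) (n k : ℕ) :
    MeasurableSet {ω | β n ω = k} :=
  hX.measurable_recall n (measurableSet_singleton k)

variable [IsProbabilityMeasure μ]

/-- `recall_law` only speaks of instants in `[1, n]`; its probabilities already sum to `1`, which
leaves no mass elsewhere. -/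
theorem ae_recall_mem (hX : IsRERW μ p q c X α β) (hc : 0 ≤ c) {n : ℕ} (hn : 1 ≤ n) :
    ∀ᵐ ω ∂μ, β (n + 1) ω ∈ Finset.Icc 1 n := by
  have hint : ∀ k, Integrable (μ⟦{ω | β (n + 1) ω = k} | rerwHistory X β n⟧) μ :=
    fun k => integrable_condExp
  have h1 : ∑ k ∈ Finset.Icc 1 n, μ.real {ω | β (n + 1) ω = k} = 1 := by
    calc ∑ k ∈ Finset.Icc 1 n, μ.real {ω | β (n + 1) ω = k}
        = ∑ k ∈ Finset.Icc 1 n, ∫ ω, (μ⟦{ω | β (n + 1) ω = k} | rerwHistory X β n⟧) ω ∂μ :=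
          Finset.sum_congr rfl fun k _ => by
            rw [integral_condExp (hX.rerwHistory_le n),
              integral_indicator_const _ (hX.measurableSet_recall_eq _ k)]
            simp
      _ = ∫ ω, ∑ k ∈ Finset.Icc 1 n, (μ⟦{ω | β (n + 1) ω = k} | rerwHistory X β n⟧) ω ∂μ :=
          (integral_finsetSum _ fun k _ => hint k).symm
      _ = ∫ _, (1 : ℝ) ∂μ := by
          refine integral_congr_ae ?_
          have h2 := (Filter.eventually_all_finset (Finset.Icc 1 n)).2 (hX.recall_law n hn)
          filter_upwards [h2] with ω hω
          rw [Finset.sum_congr rfl hω, ← Finset.sum_div,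
            div_self (sum_rerwWeight_pos hc hn).ne']
      _ = 1 := by simp
  have hU : {ω | β (n + 1) ω ∈ Finset.Icc 1 n} =
      ⋃ k ∈ Finset.Icc 1 n, {ω | β (n + 1) ω = k} := by
    ext ω; simp
  have hm : MeasurableSet {ω | β (n + 1) ω ∈ Finset.Icc 1 n} := by
    rw [hU]; exact Finset.measurableSet_biUnion _ fun k _ => hX.measurableSet_recall_eq _ k
  have h3 : μ.real {ω | β (n + 1) ω ∈ Finset.Icc 1 n} = 1 := by
    rw [hU, measureReal_biUnion_finset _ fun k _ => hX.measurableSet_recall_eq _ k, h1]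
    intro i _ j _ hij
    refine Set.disjoint_left.2 fun ω h4 h5 => hij ?_
    exact (show β (n + 1) ω = i from h4).symm.trans h5
  have h4 : μ {ω | β (n + 1) ω ∈ Finset.Icc 1 n}ᶜ = 0 :=
    (prob_compl_eq_zero_iff hm).2 (by rw [← ENNReal.toReal_eq_one_iff]; exact h3)
  exact h4

/-- Every weight is at least `1`, so each past instant has positive conditional probability. This is
the randomness behind non-degeneracy. -/
theorem not_ae_recall_ne (hX : IsRERW μ p q c X α β) (hc : 0 ≤ c) {n k : ℕ} (hn : 1 ≤ n)
    (hk : k ∈ Finset.Icc 1 n) : ¬ ∀ᵐ ω ∂μ, β (n + 1) ω ≠ k := by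
  intro h
  have h1 : {ω | β (n + 1) ω = k}.indicator (fun _ => (1 : ℝ)) =ᵐ[μ] 0 := by
    filter_upwards [h] with ω hω
    simp [hω]
  have h2 : μ⟦{ω | β (n + 1) ω = k} | rerwHistory X β n⟧ =ᵐ[μ] 0 := by
    refine (condExp_congr_ae h1).trans ?_
    rw [condExp_zero]
  obtain ⟨ω, h3, h4⟩ := (h2.and (hX.recall_law n hn k hk)).exists
  rw [h3] at h4
  have := div_pos (one_pos.trans_le (one_le_rerwWeight (b := fun m => β m ω) hc n k hk))
    (sum_rerwWeight_pos (b := fun m => β m ω) hc hn)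
  exact this.ne h4

theorem ae_sign_eq (hX : IsRERW μ p q c X α β) {n : ℕ} (hn : 1 ≤ n) :
    ∀ᵐ ω ∂μ, α (n + 1) ω = 1 ∨ α (n + 1) ω = -1 :=
  ae_eq_one_or_eq_neg_one (hX.measurable_sign _) (hX.sign_pos n hn) (hX.sign_neg n hn)

theorem ae_step_eq (hX : IsRERW μ p q c X α β) (hc : 0 ≤ c) (n : ℕ) :
    ∀ᵐ ω ∂μ, ∀ k ∈ Finset.Icc 1 (n + 1), X k ω = 1 ∨ X k ω = -1 := by
  induction n with
  | zero =>
    filter_upwards [ae_eq_one_or_eq_neg_one (hX.measurable_step 1) hX.first_step_right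
      hX.first_step_left] with ω hω
    simpa using hω
  | succ n ih =>
    filter_upwards [ih, hX.ae_sign_eq (Nat.le_add_left 1 n), hX.step_eq (n + 1) (by omega),
      hX.ae_recall_mem hc (Nat.le_add_left 1 n)] with ω h1 h2 h3 h4 k hk
    rcases Nat.lt_or_ge (n + 1) k with h | h
    · obtain rfl : k = n + 1 + 1 := by have := Finset.mem_Icc.1 hk; omega
      rw [h3]
      rcases h2 with h2 | h2 <;> rcases h1 _ h4 with h5 | h5 <;> simp [h2, h5]
    · exact h1 k (Finset.mem_Icc.2 ⟨(Finset.mem_Icc.1 hk).1, h⟩)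

theorem ae_abs_step_le (hX : IsRERW μ p q c X α β) (hc : 0 ≤ c) {n : ℕ} (hn : 1 ≤ n) :
    ∀ᵐ ω ∂μ, |X n ω| ≤ 1 := by
  filter_upwards [hX.ae_step_eq hc n] with ω h
  rcases h n (Finset.mem_Icc.2 ⟨hn, Nat.le_succ n⟩) with h | h <;> simp [h]

theorem ae_abs_recalled_step_le (hX : IsRERW μ p q c X α β) (hc : 0 ≤ c) (n : ℕ) :
    ∀ᵐ ω ∂μ, |X (β (n + 2) ω) ω| ≤ 1 := by
  filter_upwards [hX.ae_step_eq hc n, hX.ae_recall_mem hc (Nat.le_add_left 1 n)] with ω h h'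
  rcases h _ h' with h | h <;> simp [h]

theorem integrable_step (hX : IsRERW μ p q c X α β) (hc : 0 ≤ c) {n : ℕ} (hn : 1 ≤ n) :
    Integrable (X n) μ :=
  Integrable.of_bound (hX.measurable_step n).aestronglyMeasurable 1 (hX.ae_abs_step_le hc hn)

/-- Each step adds `c` to one old weight and creates a new weight `1`. The denominator of the recall
law is therefore deterministic, which makes the drifts linear in the weighted position. -/
theorem ae_sum_rerwWeight (hX : IsRERW μ p q c X α β) (hc : 0 ≤ c) (n : ℕ) :
    ∀ᵐ ω ∂μ, ∑ k ∈ Finset.Icc 1 (n + 1), rerwWeight c (fun m => β m ω) (n + 1) k =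
      1 + (c + 1) * n := by
  induction n with
  | zero => exact ae_of_all _ fun ω => by simp [rerwWeight]
  | succ n ih =>
    filter_upwards [ih, hX.ae_recall_mem hc (Nat.le_add_left 1 n)] with ω h1 h2
    have h3 := sum_rerwWeight_succ_mul (c := c) (b := fun m => β m ω) h2 (fun _ => 1)
    simp only [mul_one] at h3
    rw [h3, h1]; push_cast; ring

theorem ae_rerwWeightedPosition_succ (hX : IsRERW μ p q c X α β) (hc : 0 ≤ c) (n : ℕ) :
    ∀ᵐ ω ∂μ, rerwWeightedPosition c X β (n + 2) ω =
      rerwWeightedPosition c X β (n + 1) ω + c * X (β (n + 2) ω) ω + X (n + 2) ω := by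
  filter_upwards [hX.ae_recall_mem hc (Nat.le_add_left 1 n)] with ω h
  exact sum_rerwWeight_succ_mul (c := c) (b := fun m => β m ω) h fun k => X k ω

theorem ae_abs_rerwWeightedPosition_le (hX : IsRERW μ p q c X α β) (hc : 0 ≤ c) (n : ℕ) :
    ∀ᵐ ω ∂μ, |rerwWeightedPosition c X β (n + 1) ω| ≤ 1 + (c + 1) * n := by
  filter_upwards [hX.ae_sum_rerwWeight hc n, hX.ae_step_eq hc n] with ω h1 h2
  rw [← h1]
  refine (Finset.abs_sum_le_sum_abs _ _).trans (Finset.sum_le_sum fun k hk => ?_)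
  have h3 := one_le_rerwWeight (b := fun m => β m ω) hc (n + 1) k hk
  rw [abs_mul, abs_of_nonneg (by linarith)]
  rcases h2 k hk with h | h <;> simp [h]

theorem integrable_rerwWeightedPosition (hX : IsRERW μ p q c X α β) (hc : 0 ≤ c) (n : ℕ) :
    Integrable (rerwWeightedPosition c X β (n + 1)) μ :=
  Integrable.of_bound (((measurable_rerwWeightedPosition c (n + 1)).mono
    (hX.rerwHistory_le _) le_rfl).aestronglyMeasurable) _ (hX.ae_abs_rerwWeightedPosition_le hc n)

theorem ae_abs_rerwWeightedPosition_sub_le (hX : IsRERW μ p q c X α β) (hc : 0 ≤ c) (n : ℕ) :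
    ∀ᵐ ω ∂μ, |rerwWeightedPosition c X β (n + 2) ω - rerwWeightedPosition c X β (n + 1) ω| ≤
      c + 1 := by
  filter_upwards [hX.ae_rerwWeightedPosition_succ hc n, hX.ae_abs_recalled_step_le hc n,
    hX.ae_abs_step_le hc (Nat.le_add_left 1 (n + 1))] with ω h1 h2 h3
  rw [h1, add_assoc, add_sub_cancel_left]
  refine (abs_add_le _ _).trans (add_le_add ?_ h3)
  rw [abs_mul, abs_of_nonneg hc]
  exact mul_le_of_le_one_right hc h2

theorem ae_recalled_step_eq_sum (hX : IsRERW μ p q c X α β) (hc : 0 ≤ c) {n : ℕ} (hn : 1 ≤ n) :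
    (fun ω => X (β (n + 1) ω) ω) =ᵐ[μ] ∑ k ∈ Finset.Icc 1 n,
      X k * {ω | β (n + 1) ω = k}.indicator (fun _ => (1 : ℝ)) := by
  filter_upwards [hX.ae_recall_mem hc hn] with ω h
  rw [Finset.sum_apply, Finset.sum_eq_single_of_mem _ h]
  · simp
  · intro k _ hk
    simp [hk.symm]

theorem condExp_recalled_step (hX : IsRERW μ p q c X α β) (hc : 0 ≤ c) (n : ℕ) :
    μ[fun ω => X (β (n + 2) ω) ω | rerwHistory X β (n + 1)] =ᵐ[μ]
      fun ω => rerwWeightedPosition c X β (n + 1) ω / (1 + (c + 1) * n) := by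
  have hn : 1 ≤ n + 1 := Nat.le_add_left 1 n
  have hI : ∀ k, Integrable ({ω | β (n + 2) ω = k}.indicator (fun _ => (1 : ℝ))) μ := fun k =>
    (integrable_const _).indicator (hX.measurableSet_recall_eq _ k)
  have hXI : ∀ k ∈ Finset.Icc 1 (n + 1),
      Integrable (X k * {ω | β (n + 2) ω = k}.indicator (fun _ => (1 : ℝ))) μ := fun k hk => by
    refine (hI k).bdd_mul (c := 1) (hX.measurable_step k).aestronglyMeasurable ?_
    exact hX.ae_abs_step_le hc (Finset.mem_Icc.1 hk).1
  refine (condExp_congr_ae (hX.ae_recalled_step_eq_sum hc hn)).trans ?_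
  refine (condExp_finsetSum hXI _).trans ?_
  have h1 : ∀ k ∈ Finset.Icc 1 (n + 1), ∀ᵐ ω ∂μ,
      (μ[X k * {ω | β (n + 2) ω = k}.indicator (fun _ => (1 : ℝ)) | rerwHistory X β (n + 1)]) ω =
        X k ω * (rerwWeight c (fun m => β m ω) (n + 1) k /
          ∑ j ∈ Finset.Icc 1 (n + 1), rerwWeight c (fun m => β m ω) (n + 1) j) := fun k hk => by
    filter_upwards [condExp_mul_of_stronglyMeasurable_left (m := rerwHistory X β (n + 1))
      (measurable_step_rerwHistory hk).stronglyMeasurable (hXI k hk) (hI k),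
      hX.recall_law (n + 1) hn k hk] with ω h2 h3
    rw [h2, Pi.mul_apply, h3]
  filter_upwards [(Filter.eventually_all_finset _).2 h1, hX.ae_sum_rerwWeight hc n] with ω h2 h3
  rw [Finset.sum_apply, Finset.sum_congr rfl h2, h3, rerwWeightedPosition, Finset.sum_div]
  exact Finset.sum_congr rfl fun k _ => by ring

theorem condExp_step (hX : IsRERW μ p q c X α β) (hc : 0 ≤ c) (n : ℕ) :
    μ[X (n + 2) | rerwHistory X β (n + 1)] =ᵐ[μ]
      fun ω => (2 * p - 1) * (rerwWeightedPosition c X β (n + 1) ω / (1 + (c + 1) * n)) := by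
  have hn : 1 ≤ n + 1 := Nat.le_add_left 1 n
  have hG : rerwRecallHistory X β (n + 1) ≤ mΩ := sup_le (hX.rerwHistory_le _) (hX.measurable_recall _).comap_le
  -- A version of the recalled step measurable for `rerwRecallHistory`: on the null set where `β (n
  -- + 2)` leaves `[1, n + 1]`, the original may read steps outside the history.
  set Y : Ω → ℝ := ∑ k ∈ Finset.Icc 1 (n + 1),
    X k * {ω | β (n + 2) ω = k}.indicator (fun _ => (1 : ℝ))
  have hXY := hX.ae_recalled_step_eq_sum hc hn
  have hY : Measurable[rerwRecallHistory X β (n + 1)] Y := by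
    rw [show Y = fun ω => ∑ k ∈ Finset.Icc 1 (n + 1),
      (X k * {ω | β (n + 2) ω = k}.indicator (fun _ => (1 : ℝ))) ω from
      funext fun ω => Finset.sum_apply _ _ _]
    refine Finset.measurable_fun_sum _ fun k hk => ?_
    refine ((measurable_step_rerwHistory hk).mono le_sup_left le_rfl).mul ?_
    refine measurable_const.indicator ?_
    exact (le_sup_right : _ ≤ rerwRecallHistory X β (n + 1)) _ ⟨{k}, measurableSet_singleton k, rfl⟩
  have hα : Integrable (α (n + 2)) μ :=
    Integrable.of_bound (hX.measurable_sign _).aestronglyMeasurable 1 (by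
      filter_upwards [hX.ae_sign_eq hn] with ω h
      rcases h with h | h <;> simp [h])
  have hstep : X (n + 2) =ᵐ[μ] Y * α (n + 2) := by
    filter_upwards [hX.step_eq (n + 1) hn, hXY] with ω h1 h2
    rw [h1, Pi.mul_apply, mul_comm]
    exact congrArg (· * _) h2
  -- Once the recalled instant is known, the independent sign contributes only its mean `2 * p - 1`;
  -- the tower property then returns to the history.
  have h1 : μ[X (n + 2) | rerwRecallHistory X β (n + 1)] =ᵐ[μ] (2 * p - 1) • fun ω => X (β (n + 2) ω) ω := by
    refine (condExp_congr_ae hstep).trans ?_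
    refine (condExp_mul_of_stronglyMeasurable_left hY.stronglyMeasurable
      ((hX.integrable_step hc (by omega)).congr hstep) hα).trans ?_
    filter_upwards [condExp_indep_eq (hX.measurable_sign _).comap_le hG
      (comap_measurable _).stronglyMeasurable (hX.sign_indep (n + 1) hn), hXY] with ω h2 h3
    rw [Pi.mul_apply, h2, integral_of_ae_eq_one_or_eq_neg_one (hX.measurable_sign _)
      (hX.sign_pos _ hn) (hX.sign_neg _ hn), mul_comm]
    exact congrArg (_ * ·) h3.symm
  refine (condExp_condExp_of_le (le_sup_left : _ ≤ rerwRecallHistory X β (n + 1)) hG).symm.trans ?_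
  refine (condExp_congr_ae h1).trans ((condExp_smul ..).trans ?_)
  filter_upwards [hX.condExp_recalled_step hc n] with ω h
  rw [Pi.smul_apply, h, smul_eq_mul]

theorem condExp_rerwWeightedPosition_sub (hX : IsRERW μ p q c X α β) (hc : 0 ≤ c) (n : ℕ) :
    μ[rerwWeightedPosition c X β (n + 2) - rerwWeightedPosition c X β (n + 1) |
        rerwHistory X β (n + 1)] =ᵐ[μ]
      fun ω => (c + (2 * p - 1)) *
        (rerwWeightedPosition c X β (n + 1) ω / (1 + (c + 1) * n)) := by
  have hn : 1 ≤ n + 1 := Nat.le_add_left 1 n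
  have h1 : rerwWeightedPosition c X β (n + 2) - rerwWeightedPosition c X β (n + 1) =ᵐ[μ]
      c • (fun ω => X (β (n + 2) ω) ω) + X (n + 2) := by
    filter_upwards [hX.ae_rerwWeightedPosition_succ hc n] with ω h
    rw [Pi.sub_apply, h]
    simp only [Pi.add_apply, Pi.smul_apply, smul_eq_mul]
    ring
  have hI2 := hX.integrable_step hc (Nat.le_add_left 1 (n + 1))
  have hI1 : Integrable (c • fun ω => X (β (n + 2) ω) ω) μ := by
    refine (((hX.integrable_rerwWeightedPosition hc (n + 1)).sub
      (hX.integrable_rerwWeightedPosition hc n)).sub hI2).congr ?_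
    filter_upwards [h1] with ω h
    rw [Pi.sub_apply, h]
    simp
  filter_upwards [condExp_congr_ae (m := rerwHistory X β (n + 1)) h1,
    condExp_add (m := rerwHistory X β (n + 1)) hI1 hI2,
    condExp_smul (μ := μ) c (fun ω => X (β (n + 2) ω) ω) (rerwHistory X β (n + 1)),
    hX.condExp_recalled_step hc n, hX.condExp_step hc n] with ω h2 h3 h4 h5 h6
  rw [h2, h3, Pi.add_apply, h4, Pi.smul_apply, h5, h6, smul_eq_mul]
  ring

end IsRERW

/-! ### The two martingales and the growth factor. -/

namespace IsRERW

variable {Ω : Type*} [mΩ : MeasurableSpace Ω] {μ : Measure Ω} {p q c : ℝ}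
  {X : ℕ → Ω → ℝ} {α : ℕ → Ω → ℝ} {β : ℕ → Ω → ℕ}

theorem measurable_rerwPosition (hX : IsRERW μ p q c X α β) (n : ℕ) :
    Measurable (rerwPosition X n) :=
  Finset.measurable_fun_sum _ fun k _ => hX.measurable_step k

variable [IsProbabilityMeasure μ]

theorem memLp_rerwPosition (hX : IsRERW μ p q c X α β) (hc : 0 ≤ c) (n : ℕ) :
    MemLp (rerwPosition X n) 2 μ := by
  refine memLp_finsetSum _ fun k hk => ?_
  exact MemLp.of_bound (hX.measurable_step k).aestronglyMeasurable 1
    (hX.ae_abs_step_le hc (Finset.mem_Icc.1 hk).1)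

theorem memLp_rerwWeightedPosition (hX : IsRERW μ p q c X α β) (hc : 0 ≤ c) (n : ℕ) :
    MemLp (rerwWeightedPosition c X β (n + 1)) 2 μ :=
  MemLp.of_bound (hX.integrable_rerwWeightedPosition hc n).aestronglyMeasurable _
    (hX.ae_abs_rerwWeightedPosition_le hc n)

/-- The coefficient is the ratio of the drift of the position to that of the weighted position, so
the two drifts cancel. -/
theorem martingale_position_sub (hX : IsRERW μ p q c X α β) (hc : 0 ≤ c)
    (hac : 2 * p - 1 + c ≠ 0) :
    Martingale (fun n ω => rerwPosition X (n + 1) ω -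
      (2 * p - 1) / (2 * p - 1 + c) * rerwWeightedPosition c X β (n + 1) ω) hX.filtration μ := by
  set κ := (2 * p - 1) / (2 * p - 1 + c) with hκ
  have hS : ∀ n, Integrable (rerwPosition X n) μ := fun n =>
    (hX.memLp_rerwPosition hc n).integrable one_le_two
  refine martingale_of_condExp_sub_eq_zero_nat (fun n => ?_)
    (fun n => (hS _).sub ((hX.integrable_rerwWeightedPosition hc n).const_mul _)) fun n => ?_
  · exact ((measurable_rerwPosition_rerwHistory (n + 1)).sub
      ((measurable_rerwWeightedPosition c (n + 1)).const_mul κ)).stronglyMeasurable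
  · have h1 : ((fun ω => rerwPosition X (n + 1 + 1) ω -
          κ * rerwWeightedPosition c X β (n + 1 + 1) ω) -
        fun ω => rerwPosition X (n + 1) ω - κ * rerwWeightedPosition c X β (n + 1) ω) =
        X (n + 2) -
          κ • (rerwWeightedPosition c X β (n + 2) - rerwWeightedPosition c X β (n + 1)) := by
      ext ω
      simp only [Pi.sub_apply, Pi.smul_apply, smul_eq_mul, rerwPosition_succ (n + 1)]
      ring
    rw [h1]
    change μ[_ | rerwHistory X β (n + 1)] =ᵐ[μ] 0
    have hI := ((hX.integrable_rerwWeightedPosition hc (n + 1)).sub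
      (hX.integrable_rerwWeightedPosition hc n))
    filter_upwards [condExp_sub (m := rerwHistory X β (n + 1))
      (hX.integrable_step hc (Nat.le_add_left 1 (n + 1))) (hI.smul κ),
      condExp_smul (μ := μ) κ (rerwWeightedPosition c X β (n + 2) -
        rerwWeightedPosition c X β (n + 1)) (rerwHistory X β (n + 1)),
      hX.condExp_step hc n, hX.condExp_rerwWeightedPosition_sub hc n] with ω h2 h3 h4 h5
    rw [h2, Pi.sub_apply, h3, Pi.smul_apply, h4, h5, hκ, smul_eq_mul, Pi.zero_apply,
      add_comm c (2 * p - 1)]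
    field_simp
    ring

theorem ae_abs_position_sub_sub_le (hX : IsRERW μ p q c X α β) (hc : 0 ≤ c) (κ : ℝ) (n : ℕ) :
    ∀ᵐ ω ∂μ, |(rerwPosition X (n + 1 + 1) ω - κ * rerwWeightedPosition c X β (n + 1 + 1) ω) -
      (rerwPosition X (n + 1) ω - κ * rerwWeightedPosition c X β (n + 1) ω)| ≤
      1 + |κ| * (c + 1) := by
  filter_upwards [hX.ae_abs_step_le hc (Nat.le_add_left 1 (n + 1)),
    hX.ae_abs_rerwWeightedPosition_sub_le hc n] with ω h1 h2
  rw [rerwPosition_succ (n + 1)]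
  calc _ = |X (n + 1 + 1) ω -
        κ * (rerwWeightedPosition c X β (n + 2) ω - rerwWeightedPosition c X β (n + 1) ω)| := by
        congr 1; ring
    _ ≤ _ := (abs_sub _ _).trans (add_le_add h1 (by rw [abs_mul]; gcongr))

/-- The growth factor `∏_{j < n} (1 + (a + c) / (1 + (c + 1) j))` of the mean weighted position. -/
noncomputable def growth (a c : ℝ) (n : ℕ) : ℝ :=
  ∏ j ∈ Finset.range n, (1 + (c + a) / (1 + (c + 1) * j))

theorem growth_succ (a c : ℝ) (n : ℕ) :
    growth a c (n + 1) = growth a c n * (1 + (c + a) / (1 + (c + 1) * n)) :=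
  Finset.prod_range_succ _ _

theorem growth_pos {a c : ℝ} (hc : 0 ≤ c) (hac : 0 < a + c) (n : ℕ) : 0 < growth a c n :=
  Finset.prod_pos fun j _ => by
    have : 0 < c + a := by linarith
    positivity

/-- Dividing through by `c + 1` turns each factor into `(s + j) / (r + j)` with `r = 1 / (c + 1)`
and `s = r + (a + c) * r`. -/
theorem tendsto_growth_div {a c : ℝ} (hc : 0 ≤ c) (hac : 0 < a + c) :
    ∃ C : ℝ, 0 < C ∧ Tendsto (fun n : ℕ => growth a c n /
      ((n + 1 : ℕ) : ℝ) ^ ((a + c) * (1 / (c + 1)))) atTop (𝓝 C) := by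
  set r := 1 / (c + 1)
  have hr : 0 < r := by positivity
  have hs : 0 < r + (a + c) * r := by positivity
  refine ⟨Real.Gamma r / Real.Gamma (r + (a + c) * r),
    div_pos (Real.Gamma_pos_of_pos hr) (Real.Gamma_pos_of_pos hs), ?_⟩
  refine (tendsto_prod_range_div_rpow hr hs).congr fun n => ?_
  rw [add_sub_cancel_left, growth]
  congr 1
  refine Finset.prod_congr rfl fun j _ => ?_
  simp only [r]
  have h1 : (1 : ℝ) + (c + 1) * j ≠ 0 := by positivity
  have h2 : 1 / (c + 1) + (j : ℝ) ≠ 0 := by positivity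
  have h3 : c + 1 ≠ 0 := by positivity
  field_simp
  ring

theorem summable_inv_growth_sq {a c : ℝ} (hc : 0 ≤ c) (hac : 0 < a + c)
    (hθ : 1 / 2 < (a + c) * (1 / (c + 1))) : Summable fun n => ((growth a c n)⁻¹) ^ 2 := by
  set θ := (a + c) * (1 / (c + 1))
  obtain ⟨C, hC, h⟩ := tendsto_growth_div hc hac
  have h1 : Summable fun n : ℕ => (((n + 1 : ℕ) : ℝ) ^ (2 * θ))⁻¹ :=
    (summable_nat_add_iff 1).2 (Real.summable_nat_rpow_inv.2 (by linarith))
  refine summable_of_isBigO_nat h1 ?_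
  have h2 := (h.inv₀ hC.ne').pow 2
  refine Asymptotics.isBigO_of_div_tendsto_nhds (Eventually.of_forall fun n h0 => ?_) _
    (h2.congr fun n => ?_)
  · have : (((n + 1 : ℕ) : ℝ) ^ (2 * θ))⁻¹ ≠ 0 :=
      inv_ne_zero (Real.rpow_pos_of_pos (by positivity) _).ne'
    exact absurd h0 this
  · have h3 : ((n + 1 : ℕ) : ℝ) ^ (2 * θ) = (((n + 1 : ℕ) : ℝ) ^ θ) ^ 2 := by
      rw [mul_comm, Real.rpow_mul (by positivity), Real.rpow_two]
    simp only [Pi.div_apply, h3]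
    rw [inv_div, div_pow, inv_pow, div_inv_eq_mul]
    ring

theorem martingale_weightedPosition_div (hX : IsRERW μ p q c X α β) (hc : 0 ≤ c)
    (hac : 0 < 2 * p - 1 + c) :
    Martingale (fun n ω => (growth (2 * p - 1) c n)⁻¹ * rerwWeightedPosition c X β (n + 1) ω)
      hX.filtration μ := by
  set a := 2 * p - 1 with ha
  refine martingale_nat (fun n => ?_)
    (fun n => (hX.integrable_rerwWeightedPosition hc n).const_mul _) fun n => ?_
  · exact ((measurable_rerwWeightedPosition c (n + 1)).const_mul _).stronglyMeasurable
  · change _ =ᵐ[μ] μ[(growth a c (n + 1))⁻¹ • rerwWeightedPosition c X β (n + 2) |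
      rerwHistory X β (n + 1)]
    have hpos := growth_pos hc hac n
    have hca : 0 < c + a := by linarith
    have hW : μ[rerwWeightedPosition c X β (n + 1) | rerwHistory X β (n + 1)] =
        rerwWeightedPosition c X β (n + 1) :=
      condExp_of_stronglyMeasurable (hX.rerwHistory_le _)
        (measurable_rerwWeightedPosition c (n + 1)).stronglyMeasurable
        (hX.integrable_rerwWeightedPosition hc n)
    filter_upwards [condExp_smul (μ := μ) (growth a c (n + 1))⁻¹
      (rerwWeightedPosition c X β (n + 2)) (rerwHistory X β (n + 1)),
      condExp_sub (m := rerwHistory X β (n + 1)) (hX.integrable_rerwWeightedPosition hc (n + 1))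
        (hX.integrable_rerwWeightedPosition hc n),
      hX.condExp_rerwWeightedPosition_sub hc n] with ω h1 h2 h3
    rw [h3, Pi.sub_apply, hW] at h2
    have h4 := eq_add_of_sub_eq h2.symm
    rw [h1, Pi.smul_apply, h4, growth_succ, smul_eq_mul, ← ha]
    have h5 : 0 < 1 + (c + a) / (1 + (c + 1) * n) := by positivity
    field_simp
    ring

/-- Over the common factor `1 / growth (n + 1)`, the increment is that of `W` minus its drift. The
former is at most `c + 1`, the latter at most `c + a` because `|W|` is at most the total weight. -/
theorem ae_abs_weightedPosition_div_sub_le (hX : IsRERW μ p q c X α β) (hc : 0 ≤ c)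
    (hac : 0 < 2 * p - 1 + c) (n : ℕ) :
    ∀ᵐ ω ∂μ, |(growth (2 * p - 1) c (n + 1))⁻¹ * rerwWeightedPosition c X β (n + 1 + 1) ω -
      (growth (2 * p - 1) c n)⁻¹ * rerwWeightedPosition c X β (n + 1) ω| ≤
      (growth (2 * p - 1) c (n + 1))⁻¹ * (c + 1 + (c + (2 * p - 1))) := by
  set a := 2 * p - 1
  have hpos := growth_pos hc hac n
  have hpos' := growth_pos hc hac (n + 1)
  have hca : 0 < c + a := by linarith
  have hD : (0 : ℝ) < 1 + (c + 1) * n := by positivity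
  have h5 : 0 < 1 + (c + a) / (1 + (c + 1) * n) := by positivity
  filter_upwards [hX.ae_abs_rerwWeightedPosition_sub_le hc n,
    hX.ae_abs_rerwWeightedPosition_le hc n] with ω h1 h2
  set W := rerwWeightedPosition c X β (n + 1) ω
  have h3 : (growth a c n)⁻¹ = (growth a c (n + 1))⁻¹ * (1 + (c + a) / (1 + (c + 1) * n)) := by
    rw [growth_succ]; field_simp
  rw [h3, mul_assoc, ← mul_sub, abs_mul, abs_of_pos (inv_pos.2 hpos')]
  refine mul_le_mul_of_nonneg_left ?_ (inv_pos.2 hpos').le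
  calc _ = |(rerwWeightedPosition c X β (n + 2) ω - W) - (c + a) / (1 + (c + 1) * n) * W| := by
        congr 1; ring
    _ ≤ _ := (abs_sub _ _).trans (add_le_add h1 ?_)
  rw [abs_mul, abs_of_pos (div_pos hca hD), div_mul_eq_mul_div, div_le_iff₀ hD]
  exact mul_le_mul_of_nonneg_left h2 hca.le

/-- The normalised weighted position converges almost surely and in `L²`. -/
theorem exists_limit_weightedPosition (hX : IsRERW μ p q c X α β) (hc : 0 ≤ c)
    (hac : 0 < 2 * p - 1 + c) (hθ : 1 / 2 < (2 * p - 1 + c) * (1 / (c + 1))) :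
    ∃ M : Ω → ℝ, Measurable M ∧ MemLp M 2 μ ∧
      (∀ᵐ ω ∂μ, Tendsto (fun n => (growth (2 * p - 1) c n)⁻¹ *
        rerwWeightedPosition c X β (n + 1) ω) atTop (𝓝 (M ω))) ∧
      Tendsto (fun n => ∫ ω, ((growth (2 * p - 1) c n)⁻¹ *
        rerwWeightedPosition c X β (n + 1) ω - M ω) ^ 2 ∂μ) atTop (𝓝 0) ∧
      ∀ n, (fun ω => (growth (2 * p - 1) c n)⁻¹ * rerwWeightedPosition c X β (n + 1) ω) =ᵐ[μ]
        μ[M | rerwHistory X β (n + 1)] := by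
  refine (hX.martingale_weightedPosition_div hc hac).exists_tendsto_of_summable_sq
    (hX.ae_abs_weightedPosition_div_sub_le hc hac) ?_
    ((hX.memLp_rerwWeightedPosition hc 0).const_mul _)
  simp_rw [mul_pow]
  exact ((summable_nat_add_iff 1).2 (summable_inv_growth_sq hc hac hθ)).mul_right _

/-- A walk whose first three weighted positions are deterministic is the walk that never turns. -/
theorem eq_one_of_weightedPosition_ae_const (hX : IsRERW μ p q c X α β) (hc : 0 ≤ c)
    (hsuper : (1 - c) / 2 < 2 * p - 1)
    (h : ∀ n, ∃ w : ℝ, ∀ᵐ ω ∂μ, rerwWeightedPosition c X β (n + 1) ω = w) :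
    p = 1 ∧ (q = 0 ∨ q = 1) := by
  obtain ⟨x, hx⟩ := h 0
  obtain ⟨y, hy⟩ := h 1
  obtain ⟨z, hz⟩ := h 2
  have h1 : ∀ᵐ ω ∂μ, X 1 ω = x := by
    filter_upwards [hx] with ω hω
    rw [← hω]; simp [rerwWeightedPosition, rerwWeight]
  have hxval : x = 1 ∨ x = -1 := by
    obtain ⟨ω, h2, h3⟩ := (h1.and (hX.ae_step_eq hc 0)).exists
    rw [← h2]; exact h3 1 (by simp)
  have hx0 : x ≠ 0 := by rcases hxval with h | h <;> rw [h] <;> norm_num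
  have hq : q = 0 ∨ q = 1 := by
    rw [← hX.first_step_right, measureReal_eq_of_ae_eq_const h1]
    split_ifs <;> simp
  have hβ2 : ∀ᵐ ω ∂μ, β 2 ω = 1 := by
    filter_upwards [hX.ae_recall_mem hc le_rfl] with ω hω
    simpa using hω
  -- The only instant to recall is `1`, so `W_2 = (1 + c) x + α_2 x`: a deterministic `W_2` makes
  -- the sign `α_2` deterministic.
  have hα2 : ∀ᵐ ω ∂μ, α 2 ω = (y - (1 + c) * x) / x := by
    filter_upwards [hx, hy, h1, hβ2, hX.ae_rerwWeightedPosition_succ hc 0,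
      hX.step_eq 1 le_rfl] with ω h2 h3 h4 h5 h6 h7
    have h8 : y = x + c * x + α 2 ω * x := by
      rw [← h3, h6, h2, h7, h5, h4]
    rw [h8]; field_simp; ring
  have hp : p = 0 ∨ p = 1 := by
    rw [← hX.sign_pos 1 le_rfl, measureReal_eq_of_ae_eq_const hα2]
    split_ifs <;> simp
  refine ⟨hp.resolve_left fun hp0 => ?_, hq⟩
  -- If `p = 0` then `a = -1`, and superdiffusivity forces `c > 3`; only `c ≠ 1` matters below.
  have hc3 : 3 < c := by rw [hp0] at hsuper; linarith
  have hα : ∀ n, 1 ≤ n → ∀ᵐ ω ∂μ, α (n + 1) ω = -1 := fun n hn => by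
    have h2 : μ.real {ω | α (n + 1) ω = 1} = 0 := by rw [hX.sign_pos n hn, hp0]
    have h3 : ∀ᵐ ω ∂μ, α (n + 1) ω ≠ 1 := by
      rw [ae_iff]
      simpa using (measureReal_eq_zero_iff).1 h2
    filter_upwards [h3, hX.ae_sign_eq hn] with ω h4 h5
    exact h5.resolve_left h4
  have hX2 : ∀ᵐ ω ∂μ, X 2 ω = -x := by
    filter_upwards [hX.step_eq 1 le_rfl, hβ2, h1, hα 1 le_rfl] with ω h2 h3 h4 h5
    rw [h2, h3, h4, h5]; ring
  have hX3 : ∀ᵐ ω ∂μ, (c - 1) * X (β 3 ω) ω = z - y := by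
    filter_upwards [hy, hz, hX.ae_rerwWeightedPosition_succ hc 1, hX.step_eq 2 one_le_two,
      hα 2 one_le_two] with ω h2 h3 h4 h5 h6
    have h7 : z = y + c * X (β 3 ω) ω + -1 * X (β 3 ω) ω := by
      rw [← h3, h4, h2, h5, h6]
    rw [h7]; ring
  have hne1 := hX.not_ae_recall_ne hc one_le_two (k := 1) (by simp)
  have hne2 := hX.not_ae_recall_ne hc one_le_two (k := 2) (by simp)
  -- A deterministic `W_3` fixes the value of the third recalled step, yet `X_1 = x` and `X_2 = -x`
  -- differ. So one of the instants `1`, `2` would almost surely never be recalled.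
  by_cases hzx : (c - 1) * x = z - y
  · refine hne2 ?_
    filter_upwards [hX3, hX2] with ω h2 h3 h4
    rw [h4, h3, ← hzx] at h2
    have : 2 * (c - 1) * x = 0 := by linarith
    have h5 : 2 * (c - 1) ≠ 0 := by linarith
    exact (mul_ne_zero h5 hx0) this
  · refine hne1 ?_
    filter_upwards [hX3, h1] with ω h2 h3 h4
    rw [h4, h3] at h2
    exact hzx h2

end IsRERW

/-! ### Assembly of the limit theorem. -/

theorem integral_add_add_sq_le {Ω : Type*} [MeasurableSpace Ω] {μ : Measure Ω} {f g h : Ω → ℝ}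
    (hf : MemLp f 2 μ) (hg : MemLp g 2 μ) (hh : MemLp h 2 μ) :
    ∫ ω, (f ω + g ω + h ω) ^ 2 ∂μ ≤
      3 * (∫ ω, f ω ^ 2 ∂μ + ∫ ω, g ω ^ 2 ∂μ + ∫ ω, h ω ^ 2 ∂μ) := by
  have h1 : Integrable (fun ω => f ω ^ 2 + g ω ^ 2) μ := hf.integrable_sq.add hg.integrable_sq
  rw [← integral_add hf.integrable_sq hg.integrable_sq, ← integral_add h1 hh.integrable_sq,
    ← integral_const_mul]
  refine integral_mono_of_nonneg (ae_of_all _ fun _ => sq_nonneg _)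
    ((h1.add hh.integrable_sq).const_mul 3) (ae_of_all _ fun ω => ?_)
  change (f ω + g ω + h ω) ^ 2 ≤ 3 * (f ω ^ 2 + g ω ^ 2 + h ω ^ 2)
  nlinarith [sq_nonneg (f ω - g ω), sq_nonneg (g ω - h ω), sq_nonneg (f ω - h ω)]

theorem mainTheorem1 {Ω : Type*} [MeasurableSpace Ω] (μ : Measure Ω) [IsProbabilityMeasure μ]
    (p q c a lam : ℝ) (hp : p ∈ Set.Icc (0 : ℝ) 1) (hp2 : p ≠ 1 / 2) (hq : q ∈ Set.Icc (0 : ℝ) 1)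
    (hc : 0 ≤ c) (ha : a = 2 * p - 1) (hlam : lam = 1 / (c + 1)) (hsuper : (1 - c) / 2 < a)
    (X : ℕ → Ω → ℝ) (α : ℕ → Ω → ℝ) (β : ℕ → Ω → ℕ) (hX : IsRERW μ p q c X α β) :
    ∃ (L : Ω → ℝ) (Λ : Ω → SkorokhodSpace),
      Measurable L ∧
      (¬ (p = 1 ∧ (q = 0 ∨ q = 1)) → ¬ ∃ x : ℝ, ∀ᵐ ω ∂μ, L ω = x) ∧
      (∀ ω t, (Λ ω).toFun t = (t : ℝ) ^ (lam * (a + c)) * L ω) ∧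
      TendstoInDistribution
        (fun (n : ℕ) ω =>
          rescaledPath (fun k => rerwPosition X k ω) ((n : ℝ) ^ (lam * (a + c))) n)
        atTop Λ (fun _ => μ) μ ∧
      (∀ᵐ ω ∂μ, Tendsto (fun n : ℕ => rerwPosition X n ω / (n : ℝ) ^ ((a + c) * lam))
        atTop (𝓝 (L ω))) ∧
      MemLp L 2 μ ∧
      Tendsto (fun n : ℕ => ∫ ω, |rerwPosition X n ω / (n : ℝ) ^ ((a + c) * lam) - L ω| ^ 2 ∂μ)
        atTop (𝓝 0) := by
  subst ha hlam
  rw [mul_comm (1 / (c + 1)) (2 * p - 1 + c)]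
  have hc1 : 0 < c + 1 := by linarith
  have hθ : 1 / 2 < (2 * p - 1 + c) * (1 / (c + 1)) := by
    rw [mul_one_div, div_lt_div_iff₀ two_pos hc1]; linarith
  have hac : 0 < 2 * p - 1 + c := by
    by_contra hneg
    have := mul_nonpos_of_nonpos_of_nonneg (not_lt.1 hneg) (one_div_pos.2 hc1).le
    linarith
  have hθ1 : (2 * p - 1 + c) * (1 / (c + 1)) ≤ 1 := by
    rw [mul_one_div, div_le_one hc1]; linarith [hp.2]
  obtain ⟨C, hC, hgrowth⟩ := IsRERW.tendsto_growth_div hc hac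
  set θ := (2 * p - 1 + c) * (1 / (c + 1))
  have hθ0 : 0 < θ := by linarith
  set a := 2 * p - 1
  set κ := a / (a + c)
  -- Here `p ≠ 1/2` enters: it lets `M` be recovered from the limit `κ * C * M`, as non-degeneracy
  -- requires.
  have hκ : κ ≠ 0 := div_ne_zero (fun h => hp2 (by simp only [a] at h; linarith)) hac.ne'
  obtain ⟨M, hMm, hM2, hMlim, hMint, hMcond⟩ := hX.exists_limit_weightedPosition hc hac hθ
  have hN0 : MemLp (fun ω => rerwPosition X (0 + 1) ω -
      κ * rerwWeightedPosition c X β (0 + 1) ω) 2 μ :=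
    (hX.memLp_rerwPosition hc 1).sub ((hX.memLp_rerwWeightedPosition hc 0).const_mul κ)
  obtain ⟨hNlim, hNint⟩ := (hX.martingale_position_sub hc hac.ne').tendsto_div_rpow_zero
    (hX.ae_abs_position_sub_sub_le hc κ) hN0 hθ
  -- A negligible martingale term plus `κ` times a deterministic ratio tending to `C` times a
  -- martingale tending to `M`; it serves both modes of convergence.
  have hdecomp : ∀ (n : ℕ) (ω : Ω), rerwPosition X (n + 1) ω / ((n + 1 : ℕ) : ℝ) ^ θ =
      (rerwPosition X (n + 1) ω - κ * rerwWeightedPosition c X β (n + 1) ω) /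
        ((n + 1 : ℕ) : ℝ) ^ θ +
      κ * (IsRERW.growth a c n / ((n + 1 : ℕ) : ℝ) ^ θ) *
        ((IsRERW.growth a c n)⁻¹ * rerwWeightedPosition c X β (n + 1) ω) := fun n ω => by
    have h1 := (IsRERW.growth_pos hc hac n).ne'
    have h2 : ((n + 1 : ℕ) : ℝ) ^ θ ≠ 0 := (Real.rpow_pos_of_pos (by positivity) _).ne'
    field_simp
    ring
  have hlim : ∀ᵐ ω ∂μ, Tendsto (fun n : ℕ => rerwPosition X n ω / (n : ℝ) ^ θ) atTop
      (𝓝 (κ * C * M ω)) := by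
    filter_upwards [hNlim, hMlim] with ω h1 h2
    rw [← tendsto_add_atTop_iff_nat 1]
    simp_rw [hdecomp]
    simpa using h1.add ((hgrowth.const_mul κ).mul h2)
  refine ⟨fun ω => κ * C * M ω, fun ω => powerPath θ hθ0.le (κ * C * M ω), hMm.const_mul _, ?_,
    fun ω t => rfl, ?_, hlim, hM2.const_mul _, ?_⟩
  · rintro hnot ⟨x, hx⟩
    refine hnot (hX.eq_one_of_weightedPosition_ae_const hc hsuper fun n => ?_)
    refine ⟨IsRERW.growth a c n * (x / (κ * C)), ?_⟩
    have hM : M =ᵐ[μ] fun _ => x / (κ * C) := by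
      filter_upwards [hx] with ω hω
      rw [← hω]; field_simp
    -- Each normalised weighted position is a conditional expectation of `M`, hence constant if `M`
    -- is.
    have h1 := (hMcond n).trans (condExp_congr_ae hM)
    rw [condExp_const (hX.rerwHistory_le _)] at h1
    filter_upwards [h1] with ω hω
    rw [← hω, mul_inv_cancel_left₀ (IsRERW.growth_pos hc hac n).ne']
  · have hL : Measurable fun ω => κ * C * M ω := hMm.const_mul _
    refine tendstoInDistribution_of_ae_tendsto (fun n => ?_)
      ((continuous_powerPath θ hθ0.le).measurable.comp hL).aemeasurable ?_
    · exact ((continuous_rescaledPath _ n).measurable.comp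
        (measurable_pi_lambda _ fun k => hX.measurable_rerwPosition k)).aemeasurable
    · filter_upwards [hlim] with ω hω
      exact tendsto_rescaledPath hθ0 hθ1 hω
  · simp only [sq_abs]
    rw [← tendsto_add_atTop_iff_nat 1]
    set d : ℕ → ℝ := fun n => IsRERW.growth a c n / ((n + 1 : ℕ) : ℝ) ^ θ
    set V : ℕ → Ω → ℝ := fun n ω =>
      (IsRERW.growth a c n)⁻¹ * rerwWeightedPosition c X β (n + 1) ω
    set N : ℕ → Ω → ℝ := fun n ω =>
      (rerwPosition X (n + 1) ω - κ * rerwWeightedPosition c X β (n + 1) ω) /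
        ((n + 1 : ℕ) : ℝ) ^ θ
    have hV : ∀ n, MemLp (V n) 2 μ := fun n => (hX.memLp_rerwWeightedPosition hc n).const_mul _
    have hN : ∀ n, MemLp (N n) 2 μ := fun n => by
      have := ((hX.memLp_rerwPosition hc (n + 1)).sub
        ((hX.memLp_rerwWeightedPosition hc n).const_mul κ)).const_mul (((n + 1 : ℕ) : ℝ) ^ θ)⁻¹
      refine this.congr_norm (this.1.congr (ae_of_all _ fun ω => ?_)) (ae_of_all _ fun ω => ?_) <;>
      simp [N, div_eq_inv_mul]
    -- The error is split as `N n + κ d_n (V n - M) + κ (d_n - C) M`.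
    have hup : Tendsto (fun n => 3 * (∫ ω, N n ω ^ 2 ∂μ +
        (κ * d n) ^ 2 * ∫ ω, (V n ω - M ω) ^ 2 ∂μ +
        (κ * (d n - C)) ^ 2 * ∫ ω, M ω ^ 2 ∂μ)) atTop (𝓝 0) := by
      have h1 := ((hgrowth.const_mul κ).pow 2).mul hMint
      have h2 := (((hgrowth.sub_const C).const_mul κ).pow 2).mul_const (∫ ω, M ω ^ 2 ∂μ)
      have h3 := ((hNint.add h1).add h2).const_mul 3
      have h4 : 3 * (0 + (κ * C) ^ 2 * 0 + (κ * (C - C)) ^ 2 * ∫ ω, M ω ^ 2 ∂μ) = 0 := by ring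
      rw [h4] at h3
      exact h3
    refine tendsto_of_tendsto_of_tendsto_of_le_of_le tendsto_const_nhds hup
      (fun n => integral_nonneg fun _ => sq_nonneg _) fun n => ?_
    have h1 := integral_add_add_sq_le (hN n) (((hV n).sub hM2).const_mul (κ * d n))
      (hM2.const_mul (κ * (d n - C)))
    simp only [Pi.sub_apply, mul_pow (κ * d n), mul_pow (κ * (d n - C)), integral_const_mul] at h1
    refine le_trans (le_of_eq (integral_congr_ae (ae_of_all _ fun ω => ?_))) h1
    change (rerwPosition X (n + 1) ω / ((n + 1 : ℕ) : ℝ) ^ θ - κ * C * M ω) ^ 2 = _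
    rw [hdecomp]
    change (N n ω + κ * d n * V n ω - κ * C * M ω) ^ 2 = _
    ring
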